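/- Let \((\Gamma_1,v_1,w_1)\) and \((\Gamma_2,v_2,w_2)\) be twice-marked graphs, either both finite connected multigraphs without loop edges (marked at vertices) or both compact connected metric graphs (marked at arbitrary points), and let \((\Gamma,v_1,w_2)\) be their vertex gluing, where \(\Gamma\) is obtained by identifying \(w_1\) with \(v_2\). A divisor is a \(\mathbb Z\)-linear combination of points, and \(r\) denotes Baker–Norine rank. For a divisor \(D\) on a twice-marked graph \((\Gamma,v,w)\): - the transmission function of \(D\) is \(s^{v,w}_D:\mathbb Z^2\to\mathbb N\), \(s^{v,w}_D(a,b)=r(D+(a-1)v-bw)+1\); - \(D\) is submodular if \(r(D')-r(D'-v)-r(D'-w)+r(D'-v-w)\ge 0\) for all twists \(D'=D+av-bw\), \(a,b\in\mathbb Z\); - the transmission permutation of \(D\), if it exists, is the unique permutation \(\tau=\tau^{v,w}_D\) of \(\mathbb Z\) such that \(r(D+av-bw)+1=\#\{n\ge b:\tau(n)\le a\}\) for all \(a,b\in\mathbb Z\). For \(s_1,s_2:\mathbb Z^2\to\mathbb N\) put \((s_1\star s_2)(a,b)=\min_{\ell\in\mathbb Z}\bigl(s_1(a,\ell)+s_2(\ell,b)\bigr)\).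 For a permutation \(\tau\) of \(\mathbb Z\) put \(s_\tau(a,b)=\#\{n\ge b:\tau(n)<a\}\); \(\tau\) is almost-sign-preserving if \(s_\tau(0,0)\) and \(s_{\tau^{-1}}(0,0)\) are finite. The Demazure product \(\alpha\star\beta\) of almost-sign-preserving permutations, if it exists, is the unique almost-sign-preserving permutation with \(s_{\alpha\star\beta}=s_\alpha\star s_\beta\). **Theorem.** Let \(D=D_1+D_2\) be a divisor on \(\Gamma\), where \(D_i\) is a divisor on \(\Gamma_i\), regarded as a divisor on \(\Gamma\) via \(\Gamma_i\subset\Gamma\). Then \[ s^{v_1,w_2}_D=s^{v_1,w_1}_{D_1}\star s^{v_2,w_2}_{D_2}. \] In particular, if \(D_1\), \(D_2\) and \(D\) are submodular (with respect to \((v_1,w_1)\), \((v_2,w_2)\) and \((v_1,w_2)\) respectively), then the transmission permutations \(\tau^{v_1,w_1}_{D_1}\), \(\tau^{v_2,w_2}_{D_2}\), \(\tau^{v_1,w_2}_D\) exist and are almost-sign-preserving, the Demazure product of the first two exists, and \[ \tau^{v_1,w_2}_D=\tau^{v_1,w_1}_{D_1}\star\tau^{v_2,w_2}_{D_2}. \]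 -/

import Mathlib

open Set

noncomputable section

namespace VertexGluing

universe u v u' v'

/-! ### Divisors, linear equivalence and Baker--Norine rank

A divisor on a finite or metric graph with set of points `X` is an element of `X →₀ ℤ`.  The
notions of this section depend only on the set `P` of principal divisors, which is defined
separately for finite graphs and for metric graphs below. -/

section Divisors

variable {X : Type u}

/-- The degree of a divisor. -/
def degree (D : X →₀ ℤ) : ℤ := D.sum fun _ n => n

/-- Linear equivalence: the difference is principal. -/
def LinEquiv (P : Set (X →₀ ℤ)) (D E : X →₀ ℤ) : Prop := D - E ∈ P

/-- The Baker--Norine rank: the largest `r ≥ -1` such that `D - E` is linearly equivalent to an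
effective divisor for all effective divisors `E` of degree `r`.  (There is no effective divisor
of degree `-1`, so `r = -1` always qualifies; no `r > max (deg D) (-1)` does.) -/
def rank (P : Set (X →₀ ℤ)) (D : X →₀ ℤ) : ℤ :=
  sSup {r : ℤ | -1 ≤ r ∧
    ∀ E : X →₀ ℤ, 0 ≤ E → degree E = r → ∃ F : X →₀ ℤ, 0 ≤ F ∧ LinEquiv P (D - E) F}

/-- The twist `D + a v - b w`. -/
def twist (v w : X) (D : X →₀ ℤ) (a b : ℤ) : X →₀ ℤ :=
  D + Finsupp.single v a - Finsupp.single w b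

/-- `Δ(D) = r(D) - r(D - v) - r(D - w) + r(D - v - w)`. -/
def rankDelta (P : Set (X →₀ ℤ)) (v w : X) (D : X →₀ ℤ) : ℤ :=
  rank P D - rank P (D - Finsupp.single v 1) - rank P (D - Finsupp.single w 1)
    + rank P (D - Finsupp.single v 1 - Finsupp.single w 1)

/-- `D` is submodular with respect to `v, w`: `Δ(D') ≥ 0` for all twists `D'` of `D`. -/
def Submodular (P : Set (X →₀ ℤ)) (v w : X) (D : X →₀ ℤ) : Prop :=
  ∀ a b : ℤ, 0 ≤ rankDelta P v w (twist v w D a b)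

/-- The transmission function `s(a, b) = r(D + (a - 1) v - b w) + 1`, a natural number because
ranks are at least `-1`. -/
def transmission (P : Set (X →₀ ℤ)) (v w : X) (D : X →₀ ℤ) (a b : ℤ) : ℕ :=
  (rank P (twist v w D (a - 1) b) + 1).toNat

/-- `r(D + a v - b w) + 1 = #{n ≥ b : τ(n) ≤ a}` for all `a, b` (all these sets being finite). -/
def RankCount (P : Set (X →₀ ℤ)) (v w : X) (D : X →₀ ℤ) (τ : Equiv.Perm ℤ) : Prop :=
  ∀ a b : ℤ, {n : ℤ | b ≤ n ∧ τ n ≤ a}.Finite ∧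
    rank P (twist v w D a b) + 1 = ({n : ℤ | b ≤ n ∧ τ n ≤ a}.ncard : ℤ)

/-- `τ` is the transmission permutation of `D` with respect to `v, w`: the unique permutation
of `ℤ` satisfying `RankCount`. -/
def IsTransmissionPerm (P : Set (X →₀ ℤ)) (v w : X) (D : X →₀ ℤ) (τ : Equiv.Perm ℤ) : Prop :=
  RankCount P v w D τ ∧ ∀ τ' : Equiv.Perm ℤ, RankCount P v w D τ' → τ' = τ

end Divisors

/-! ### Tropical products and Demazure products -/

/-- The tropical (min-plus) matrix product `(s₁ ⋆ s₂)(a, b) = min_ℓ s₁(a, ℓ) + s₂(ℓ, b)`; the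
infimum of a nonempty family of natural numbers is a minimum. -/
def tropMul (s₁ s₂ : ℤ → ℤ → ℕ) (a b : ℤ) : ℕ := ⨅ l : ℤ, s₁ a l + s₂ l b

/-- `s_τ(a, b) = #{n ≥ b : τ(n) < a}`, used for almost-sign-preserving `τ`, for which all these
sets are finite. -/
def permCount (τ : Equiv.Perm ℤ) (a b : ℤ) : ℕ := {n : ℤ | b ≤ n ∧ τ n < a}.ncard

/-- `s_τ(0, 0)` and `s_{τ⁻¹}(0, 0)` are finite. -/
def AlmostSignPreserving (τ : Equiv.Perm ℤ) : Prop :=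
  {n : ℤ | 0 ≤ n ∧ τ n < 0}.Finite ∧ {n : ℤ | 0 ≤ n ∧ τ⁻¹ n < 0}.Finite

/-- `τ = α ⋆ β`: `α`, `β` are almost-sign-preserving and `τ` is the unique almost-sign-preserving
permutation with `s_τ = s_α ⋆ s_β`. -/
def IsDemazureProduct (α β τ : Equiv.Perm ℤ) : Prop :=
  AlmostSignPreserving α ∧ AlmostSignPreserving β ∧ AlmostSignPreserving τ ∧
    permCount τ = tropMul (permCount α) (permCount β) ∧
    ∀ τ' : Equiv.Perm ℤ, AlmostSignPreserving τ' →
      permCount τ' = tropMul (permCount α) (permCount β) → τ' = τ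

/-! ### The wedge of two sets of points -/

/-- The disjoint union of `X` and `Y` with the points `x₀` and `y₀` identified. -/
def Wedge {X : Type u} {Y : Type v} (x₀ : X) (y₀ : Y) : Type (max u v) :=
  Quot fun p q : X ⊕ Y => p = Sum.inl x₀ ∧ q = Sum.inr y₀

namespace Wedge

variable {X : Type u} {Y : Type v} {x₀ : X} {y₀ : Y}

/-- The inclusion of the first summand. -/
def inl (x : X) : Wedge x₀ y₀ := Quot.mk _ (Sum.inl x)

/-- The inclusion of the second summand. -/
def inr (y : Y) : Wedge x₀ y₀ := Quot.mk _ (Sum.inr y)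

theorem glue : (inl x₀ : Wedge x₀ y₀) = inr y₀ := Quot.sound ⟨rfl, rfl⟩

theorem ind {p : Wedge x₀ y₀ → Prop} (h₁ : ∀ x, p (inl x)) (h₂ : ∀ y, p (inr y)) (z) : p z :=
  Quot.ind (fun s => Sum.rec h₁ h₂ s) z

open Classical in
/-- A normal form, used to decide equality in the wedge. -/
def normal : Wedge x₀ y₀ → X ⊕ Y :=
  Quot.lift (Sum.elim Sum.inl fun y => if y = y₀ then Sum.inl x₀ else Sum.inr y) (by
    rintro _ _ ⟨rfl, rfl⟩
    simp)

theorem inl_injective : Function.Injective (inl : X → Wedge x₀ y₀) := fun x x' h => by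
  simpa [normal, inl] using congrArg normal h

theorem inr_injective : Function.Injective (inr : Y → Wedge x₀ y₀) := fun y y' h => by
  have := congrArg normal h
  simp only [normal, inr, Sum.elim_inr] at this
  split_ifs at this <;> simp_all

theorem inl_eq_inr {x : X} {y : Y} : (inl x : Wedge x₀ y₀) = inr y ↔ x = x₀ ∧ y = y₀ := by
  constructor
  · intro h
    have := congrArg normal h
    simp only [normal, inr, inl, Sum.elim_inr, Sum.elim_inl] at this
    split_ifs at this <;> simp_all
  · rintro ⟨rfl, rfl⟩; exact glue

end Wedge

/-! ### Finite graphs -/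

/-- A finite connected multigraph without loop edges, with vertex set `V`. -/
structure FiniteGraph (V : Type u) (E : Type v) extends Graph V E where
  vertexSet_eq : vertexSet = Set.univ
  finite_vertices : Finite V
  finite_edges : edgeSet.Finite
  loopless : ∀ e x, ¬ IsLink e x x
  connected : ∀ x y : V, Relation.ReflTransGen (fun a b => ∃ e, IsLink e a b) x y

namespace FiniteGraph

/-- The principal divisors: those of the form `∑_x (∑_y m(x, y) (f(y) - f(x))) x` for an integer
function `f` on the vertices, with `m(x, y)` the number of edges joining `x` and `y`. -/
def principal {V : Type u} {E : Type v} (G : FiniteGraph V E) : Set (V →₀ ℤ) :=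
  {D | ∃ f : V → ℤ, ∀ x : V,
    D x = ∑ᶠ y : V, ({e : E | G.IsLink e x y}.ncard : ℤ) * (f y - f x)}

variable {V₁ : Type u} {E₁ : Type v} {V₂ : Type u'} {E₂ : Type v'}

/-- Incidence in the vertex gluing: every edge keeps its (images of) ends. -/
def glueLink (G₁ : FiniteGraph V₁ E₁) (G₂ : FiniteGraph V₂ E₂) (w₁ : V₁) (v₂ : V₂) :
    E₁ ⊕ E₂ → Wedge w₁ v₂ → Wedge w₁ v₂ → Prop
  | Sum.inl e, x, y => ∃ a b, G₁.IsLink e a b ∧ x = Wedge.inl a ∧ y = Wedge.inl b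
  | Sum.inr e, x, y => ∃ a b, G₂.IsLink e a b ∧ x = Wedge.inr a ∧ y = Wedge.inr b

/-- The vertex gluing of two finite graphs, `w₁` being glued to `v₂`. -/
def vertexGluing (G₁ : FiniteGraph V₁ E₁) (G₂ : FiniteGraph V₂ E₂) (w₁ : V₁) (v₂ : V₂) :
    FiniteGraph (Wedge w₁ v₂) (E₁ ⊕ E₂) where
  vertexSet := Set.univ
  IsLink := glueLink G₁ G₂ w₁ v₂
  isLink_symm := by
    rintro (e | e) - <;> constructor <;> rintro _ _ ⟨a, b, h, rfl, rfl⟩ <;>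
      exact ⟨b, a, h.symm, rfl, rfl⟩
  eq_or_eq_of_isLink_of_isLink := by
    rintro (e | e) _ _ _ _ ⟨a, b, h, rfl, rfl⟩ ⟨c, d, h', rfl, rfl⟩
    · rcases G₁.eq_or_eq_of_isLink_of_isLink h h' with rfl | rfl <;> simp
    · rcases G₂.eq_or_eq_of_isLink_of_isLink h h' with rfl | rfl <;> simp
  left_mem_of_isLink := fun _ _ _ _ => Set.mem_univ _
  vertexSet_eq := rfl
  finite_vertices := by
    have := G₁.finite_vertices
    have := G₂.finite_vertices
    exact Quot.finite _
  finite_edges := by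
    refine ((G₁.finite_edges.image Sum.inl).union (G₂.finite_edges.image Sum.inr)).subset ?_
    rintro (e | e) ⟨_, _, a, b, h, -, -⟩
    · exact Or.inl ⟨e, h.edge_mem, rfl⟩
    · exact Or.inr ⟨e, h.edge_mem, rfl⟩
  loopless := by
    rintro (e | e) x ⟨a, b, h, hx, hx'⟩
    · have := Wedge.inl_injective (hx.symm.trans hx')
      subst this; exact G₁.loopless _ _ h
    · have := Wedge.inr_injective (hx.symm.trans hx')
      subst this; exact G₂.loopless _ _ h
  connected := by
    have h₁ : ∀ x y : V₁, Relation.ReflTransGen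
        (fun a b => ∃ e, glueLink G₁ G₂ w₁ v₂ e a b) (Wedge.inl x) (Wedge.inl y) := fun x y =>
      (G₁.connected x y).lift _ fun a b ⟨e, h⟩ => ⟨Sum.inl e, a, b, h, rfl, rfl⟩
    have h₂ : ∀ x y : V₂, Relation.ReflTransGen
        (fun a b => ∃ e, glueLink G₁ G₂ w₁ v₂ e a b) (Wedge.inr x) (Wedge.inr y) := fun x y =>
      (G₂.connected x y).lift _ fun a b ⟨e, h⟩ => ⟨Sum.inr e, a, b, h, rfl, rfl⟩
    refine Wedge.ind (fun x => Wedge.ind (fun y => h₁ x y) fun y => ?_)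
      (fun x => Wedge.ind (fun y => ?_) fun y => h₂ x y)
    · exact (h₁ x w₁).trans (Wedge.glue (x₀ := w₁) (y₀ := v₂) ▸ h₂ v₂ y)
    · exact (h₂ x v₂).trans (Wedge.glue (x₀ := w₁) (y₀ := v₂) ▸ h₁ w₁ y)

end FiniteGraph

/-! ### Metric graphs -/

/-- A (compact, connected) metric graph with set of points `X`: the quotient of finitely many
closed intervals `[0, len e]` by an identification of points that affects only finitely many
points.  The identified points need not be endpoints, so any point of `X` may be treated like a
vertex; degenerate intervals of length `0` are allowed, so a single point is a metric graph.
`X` carries the quotient topology, and is required to be connected. -/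
structure MetricGraph (X : Type u) (E : Type v) [Fintype E] where
  /-- the lengths of the intervals -/
  len : E → ℝ
  len_nonneg : ∀ e, 0 ≤ len e
  /-- the quotient map -/
  param : (Σ e, Icc (0 : ℝ) (len e)) → X
  surjective : Function.Surjective param
  finite_ident : {p | ∃ q, q ≠ p ∧ param q = param p}.Finite
  connected : @ConnectedSpace X (TopologicalSpace.coinduced param inferInstance)

/-- `d` is the divisor of the continuous piecewise linear function `g` with integer slopes on the
interval `[0, L]`: there is a subdivision `0 = t₀ ≤ ⋯ ≤ tₙ = L` such that `g` has constant slope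
`mᵢ ∈ ℤ` on `[tᵢ, tᵢ₊₁]`, and `d` assigns to each point the sum of the outgoing slopes of `g`. -/
def IsDivOn {L : ℝ} (g : Icc (0 : ℝ) L → ℝ) (d : Icc (0 : ℝ) L →₀ ℤ) : Prop :=
  ∃ (n : ℕ) (t : Fin (n + 1) → Icc (0 : ℝ) L) (m : Fin n → ℤ),
    Monotone t ∧ (t 0 : ℝ) = 0 ∧ (t (Fin.last n) : ℝ) = L ∧
    (∀ i : Fin n, ∀ s ∈ Icc (t i.castSucc) (t i.succ),
      g s = g (t i.castSucc) + (m i : ℝ) * ((s : ℝ) - (t i.castSucc : ℝ))) ∧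
    d = ∑ i : Fin n, (Finsupp.single (t i.castSucc) (m i) - Finsupp.single (t i.succ) (m i))

namespace MetricGraph

/-- The principal divisors: the divisors of the rational functions, that is, of the continuous
functions `f` on the metric graph that are piecewise linear with integer slopes; the coefficient
at a point is the sum of the outgoing slopes of `f` in all directions at that point. -/
def principal {X : Type u} {E : Type v} [Fintype E] (Γ : MetricGraph X E) : Set (X →₀ ℤ) :=
  {D | ∃ (f : X → ℝ) (d : ∀ e, Icc (0 : ℝ) (Γ.len e) →₀ ℤ),
    (∀ e, IsDivOn (fun t => f (Γ.param ⟨e, t⟩)) (d e)) ∧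
    D = ∑ e, (d e).mapDomain fun t => Γ.param ⟨e, t⟩}

theorem finite_fiber {X : Type u} {E : Type v} [Fintype E] (Γ : MetricGraph X E) (x : X) :
    (Γ.param ⁻¹' {x}).Finite := by
  by_cases h : (Γ.param ⁻¹' {x}).Subsingleton
  · exact h.finite
  · refine Γ.finite_ident.subset fun p hp => ?_
    by_contra hn
    refine h fun q hq r hr => ?_
    have key : ∀ q ∈ Γ.param ⁻¹' {x}, q = p := fun q hq => by
      by_contra hqp
      exact hn ⟨q, hqp, hq.trans hp.symm⟩
    rw [key q hq, key r hr]

variable {X₁ : Type u} {E₁ : Type v} [Fintype E₁] {X₂ : Type u'} {E₂ : Type v'} [Fintype E₂]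

/-- The quotient map of the vertex gluing. -/
def glueParam (Γ₁ : MetricGraph X₁ E₁) (Γ₂ : MetricGraph X₂ E₂) (w₁ : X₁) (v₂ : X₂) :
    (Σ e : E₁ ⊕ E₂, Icc (0 : ℝ) (Sum.elim Γ₁.len Γ₂.len e)) → Wedge w₁ v₂
  | ⟨Sum.inl e, t⟩ => Wedge.inl (Γ₁.param ⟨e, t⟩)
  | ⟨Sum.inr e, t⟩ => Wedge.inr (Γ₂.param ⟨e, t⟩)

/-- The vertex gluing of two metric graphs, `w₁` being glued to `v₂` (arbitrary points). -/
def vertexGluing (Γ₁ : MetricGraph X₁ E₁) (Γ₂ : MetricGraph X₂ E₂) (w₁ : X₁) (v₂ : X₂) :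
    MetricGraph (Wedge w₁ v₂) (E₁ ⊕ E₂) where
  len := Sum.elim Γ₁.len Γ₂.len
  len_nonneg := by
    rintro (e | e)
    · exact Γ₁.len_nonneg e
    · exact Γ₂.len_nonneg e
  param := glueParam Γ₁ Γ₂ w₁ v₂
  surjective := by
    refine Wedge.ind (fun x => ?_) (fun y => ?_)
    · obtain ⟨⟨e, t⟩, rfl⟩ := Γ₁.surjective x
      exact ⟨⟨Sum.inl e, t⟩, rfl⟩
    · obtain ⟨⟨e, t⟩, rfl⟩ := Γ₂.surjective y
      exact ⟨⟨Sum.inr e, t⟩, rfl⟩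
  finite_ident := by
    let i₁ : (Σ e, Icc (0 : ℝ) (Γ₁.len e)) →
        (Σ e : E₁ ⊕ E₂, Icc (0 : ℝ) (Sum.elim Γ₁.len Γ₂.len e)) := fun p => ⟨Sum.inl p.1, p.2⟩
    let i₂ : (Σ e, Icc (0 : ℝ) (Γ₂.len e)) →
        (Σ e : E₁ ⊕ E₂, Icc (0 : ℝ) (Sum.elim Γ₁.len Γ₂.len e)) := fun p => ⟨Sum.inr p.1, p.2⟩
    refine (((Γ₁.finite_ident.union (Γ₁.finite_fiber w₁)).image i₁).union
      ((Γ₂.finite_ident.union (Γ₂.finite_fiber v₂)).image i₂)).subset ?_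
    rintro ⟨e | e, t⟩ ⟨⟨e' | e', t'⟩, hne, h⟩
    · refine Or.inl ⟨⟨e, t⟩, Or.inl ⟨⟨e', t'⟩, ?_, Wedge.inl_injective h⟩, rfl⟩
      exact fun h' => hne (congrArg i₁ h')
    · exact Or.inl ⟨⟨e, t⟩, Or.inr (Wedge.inl_eq_inr.1 h.symm).1, rfl⟩
    · exact Or.inr ⟨⟨e, t⟩, Or.inr (Wedge.inl_eq_inr.1 h).2, rfl⟩
    · refine Or.inr ⟨⟨e, t⟩, Or.inl ⟨⟨e', t'⟩, ?_, Wedge.inr_injective h⟩, rfl⟩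
      exact fun h' => hne (congrArg i₂ h')
  connected := by
    let i₁ : (Σ e, Icc (0 : ℝ) (Γ₁.len e)) →
        (Σ e : E₁ ⊕ E₂, Icc (0 : ℝ) (Sum.elim Γ₁.len Γ₂.len e)) := fun p => ⟨Sum.inl p.1, p.2⟩
    let i₂ : (Σ e, Icc (0 : ℝ) (Γ₂.len e)) →
        (Σ e : E₁ ⊕ E₂, Icc (0 : ℝ) (Sum.elim Γ₁.len Γ₂.len e)) := fun p => ⟨Sum.inr p.1, p.2⟩
    have hi₁ : Continuous i₁ := continuous_sigma fun e =>
      continuous_sigmaMk (σ := fun e : E₁ ⊕ E₂ => Icc (0 : ℝ) (Sum.elim Γ₁.len Γ₂.len e))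
        (i := Sum.inl e)
    have hi₂ : Continuous i₂ := continuous_sigma fun e =>
      continuous_sigmaMk (σ := fun e : E₁ ⊕ E₂ => Icc (0 : ℝ) (Sum.elim Γ₁.len Γ₂.len e))
        (i := Sum.inr e)
    let τ₁ : TopologicalSpace X₁ := TopologicalSpace.coinduced Γ₁.param inferInstance
    let τ₂ : TopologicalSpace X₂ := TopologicalSpace.coinduced Γ₂.param inferInstance
    let τ : TopologicalSpace (Wedge w₁ v₂) :=
      TopologicalSpace.coinduced (glueParam Γ₁ Γ₂ w₁ v₂) inferInstance
    have cp : Continuous (glueParam Γ₁ Γ₂ w₁ v₂) := continuous_coinduced_rng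
    have c₁ : Continuous (Wedge.inl : X₁ → Wedge w₁ v₂) :=
      continuous_coinduced_dom.2 (cp.comp hi₁)
    have c₂ : Continuous (Wedge.inr : X₂ → Wedge w₁ v₂) :=
      continuous_coinduced_dom.2 (cp.comp hi₂)
    have k₁ : ConnectedSpace X₁ := Γ₁.connected
    have k₂ : ConnectedSpace X₂ := Γ₂.connected
    have hu : IsConnected (range (Wedge.inl : X₁ → Wedge w₁ v₂) ∪
        range (Wedge.inr : X₂ → Wedge w₁ v₂)) :=
      (isConnected_range c₁).union ⟨Wedge.inl w₁, ⟨w₁, rfl⟩, ⟨v₂, Wedge.glue.symm⟩⟩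
        (isConnected_range c₂)
    have huniv : range (Wedge.inl : X₁ → Wedge w₁ v₂) ∪
        range (Wedge.inr : X₂ → Wedge w₁ v₂) = univ :=
      eq_univ_of_forall (Wedge.ind (fun x => Or.inl ⟨x, rfl⟩) fun y => Or.inr ⟨y, rfl⟩)
    exact connectedSpace_iff_univ.2 (huniv ▸ hu)

end MetricGraph

end VertexGluing

end

open VertexGluing

noncomputable section

namespace VertexGluing

universe u v

/-! ### Rank relative to an abstract group of principal divisors -/

section Divisors

variable {X : Type u} {Y : Type v}

/-! Only two properties of principal divisors matter: `IsRiemann` (a group of degree-zero divisors,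
with every divisor of large degree equivalent to an effective one) and `IsGlued` (principal divisors
on the gluing are sums of principal divisors on the pieces, because functions on the pieces can be
made to agree at the glued point by adding a constant).

A divisor on the gluing splits into its two parts uniquely up to moving chips between the two names
of the glued point. Hence `D₁ + D₂` has an effective representative iff, for some `l`, both `D₁ - l
w₁` and `D₂ + l v₂` do (`IsGlued.isEff_iff`). Testing against effective divisors `A + B` and using
that the rank of `D₁ - l w₁` decreases in `l` while that of `D₂ + l v₂` increases turns this
existence statement into the minimum over `l` of a sum of two ranks (`IsGlued.lt_rankSucc_iff`).
This is the tropical product formula.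

For the permutations, the transmission function vanishes in negative degree and is degree minus a
constant in large degree (`IsRiemann.exists_rankSucc_eq`). With unit steps and submodularity, such a
function counts inversions of a unique permutation (`exists_perm_of_submodular`,
`perm_ext_of_ncard`), and the Demazure identity is then the tropical formula itself.

`IsRiemann` is proved without Riemann–Roch: solve a Poisson equation over the reals
(`exists_laplacian_eq`) and round the solution to an integral one, losing at most one chip at each
end of each edge or segment. -/

theorem degree_add (D E : X →₀ ℤ) : degree (D + E) = degree D + degree E :=
  Finsupp.sum_add_index' (fun _ => rfl) fun _ _ _ => rfl

theorem degree_zero : degree (0 : X →₀ ℤ) = 0 := Finsupp.sum_zero_index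

theorem degree_neg (D : X →₀ ℤ) : degree (-D) = -degree D := by
  have h := degree_add D (-D)
  rw [add_neg_cancel] at h
  have h0 := degree_zero (X := X)
  omega

theorem degree_sub (D E : X →₀ ℤ) : degree (D - E) = degree D - degree E := by
  rw [sub_eq_add_neg, degree_add, degree_neg, sub_eq_add_neg]

theorem degree_single (x : X) (n : ℤ) : degree (Finsupp.single x n) = n :=
  Finsupp.sum_single_index rfl

theorem degree_nonneg {D : X →₀ ℤ} (h : 0 ≤ D) : 0 ≤ degree D :=
  Finset.sum_nonneg fun x _ => h x

theorem degree_mapDomain (f : X → Y) (D : X →₀ ℤ) : degree (D.mapDomain f) = degree D :=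
  Finsupp.sum_mapDomain_index (fun _ => rfl) fun _ _ _ => rfl

theorem degree_sum {ι : Type*} (s : Finset ι) (D : ι → X →₀ ℤ) :
    degree (∑ i ∈ s, D i) = ∑ i ∈ s, degree (D i) := by
  classical
  induction s using Finset.induction_on with
  | empty => simp [degree_zero]
  | insert i s hi ih => rw [Finset.sum_insert hi, Finset.sum_insert hi, degree_add, ih]

theorem mapDomain_nonneg (f : X → Y) {D : X →₀ ℤ} (h : 0 ≤ D) : 0 ≤ D.mapDomain f := by
  refine Finset.sum_nonneg fun x _ => ?_
  exact Finsupp.single_nonneg.2 (h x)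

/-- The class of `D` contains an effective divisor. -/
def IsEff (P : Set (X →₀ ℤ)) (D : X →₀ ℤ) : Prop := ∃ F : X →₀ ℤ, 0 ≤ F ∧ LinEquiv P D F

/-- `D - E` is equivalent to an effective divisor for all effective `E` of degree `k`. -/
def HasRank (P : Set (X →₀ ℤ)) (D : X →₀ ℤ) (k : ℤ) : Prop :=
  ∀ E : X →₀ ℤ, 0 ≤ E → degree E = k → IsEff P (D - E)

/-- The rank plus one, as a natural number. -/
def rankSucc (P : Set (X →₀ ℤ)) (D : X →₀ ℤ) : ℕ := (rank P D + 1).toNat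

/-- A group of divisors of degree zero such that all divisors of large degree are equivalent to
effective divisors. -/
structure IsRiemann (P : Set (X →₀ ℤ)) : Prop where
  nonempty : Nonempty X
  add_mem : ∀ D ∈ P, ∀ E ∈ P, D + E ∈ P
  neg_mem : ∀ D ∈ P, -D ∈ P
  degree_eq : ∀ D ∈ P, degree D = 0
  isEff : ∃ N : ℤ, ∀ D, N ≤ degree D → IsEff P D

variable {P : Set (X →₀ ℤ)}

theorem IsEff.add {D E : X →₀ ℤ} (h : IsEff P D) (hE : 0 ≤ E) : IsEff P (D + E) := by
  obtain ⟨F, hF, hD⟩ := h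
  refine ⟨F + E, add_nonneg hF hE, ?_⟩
  unfold LinEquiv at *
  rwa [add_sub_add_right_eq_sub]

namespace IsRiemann

variable (hP : IsRiemann P)
include hP

theorem degree_eq_of_linEquiv {D E : X →₀ ℤ} (h : LinEquiv P D E) : degree D = degree E := by
  have := hP.degree_eq _ h
  rw [degree_sub] at this
  omega

theorem degree_nonneg_of_isEff {D : X →₀ ℤ} (h : IsEff P D) : 0 ≤ degree D := by
  obtain ⟨F, hF, hD⟩ := h
  rw [hP.degree_eq_of_linEquiv hD]
  exact degree_nonneg hF

theorem isEff_congr {D E : X →₀ ℤ} (h : D - E ∈ P) : IsEff P D ↔ IsEff P E := by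
  constructor
  · rintro ⟨F, hF, hD⟩
    refine ⟨F, hF, ?_⟩
    have := hP.add_mem _ hD _ (hP.neg_mem _ h)
    unfold LinEquiv
    convert this using 1
    abel
  · rintro ⟨F, hF, hD⟩
    refine ⟨F, hF, ?_⟩
    have := hP.add_mem _ hD _ h
    unfold LinEquiv
    convert this using 1
    abel

theorem hasRank_le_degree {D : X →₀ ℤ} {k : ℤ} (hk : 0 ≤ k) (h : HasRank P D k) :
    k ≤ degree D := by
  obtain ⟨x⟩ := hP.nonempty
  have := hP.degree_nonneg_of_isEff (h (Finsupp.single x k) (Finsupp.single_nonneg.2 hk)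
    (degree_single x k))
  rw [degree_sub, degree_single] at this
  omega

theorem hasRank_of_le {D : X →₀ ℤ} {k l : ℤ} (hkl : k ≤ l) (h : HasRank P D l) :
    HasRank P D k := by
  intro E hE hk
  obtain ⟨x⟩ := hP.nonempty
  have hx : 0 ≤ Finsupp.single x (l - k) := Finsupp.single_nonneg.2 (by omega)
  have := (h (E + Finsupp.single x (l - k)) (add_nonneg hE hx)
    (by rw [degree_add, degree_single]; omega)).add hx
  convert this using 1
  abel

theorem rank_mem (D : X →₀ ℤ) : -1 ≤ rank P D ∧ HasRank P D (rank P D) := by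
  -- A supremum in `ℤ` is attained only for a nonempty set bounded above: `-1` belongs vacuously,
  -- and `max (degree D) (-1)` bounds the set.
  refine Int.csSup_mem (s := {r : ℤ | -1 ≤ r ∧ HasRank P D r}) ⟨-1, le_rfl, ?_⟩
    ⟨max (degree D) (-1), ?_⟩
  · intro E hE h
    have := degree_nonneg hE
    omega
  · rintro r ⟨hr, h⟩
    rcases hr.lt_or_eq with h' | h'
    · exact le_max_of_le_left (hP.hasRank_le_degree (by omega) h)
    · exact le_max_of_le_right h'.ge

theorem rankSucc_eq (D : X →₀ ℤ) : (rankSucc P D : ℤ) = rank P D + 1 :=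
  Int.toNat_of_nonneg (by have := (hP.rank_mem D).1; omega)

/-- The working form of the rank: later equalities and inequalities of ranks are mostly checked by
comparing the sets of `k` below them, so the supremum is not met again. -/
theorem lt_rankSucc_iff {D : X →₀ ℤ} {k : ℕ} : k < rankSucc P D ↔ HasRank P D k := by
  have hs := hP.rankSucc_eq D
  have hm := hP.rank_mem D
  constructor
  · intro h
    exact hP.hasRank_of_le (by omega) hm.2
  · intro h
    have : (k : ℤ) ≤ rank P D := by
      refine le_csSup (s := {r : ℤ | -1 ≤ r ∧ HasRank P D r}) ⟨max (degree D) (-1), ?_⟩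
        ⟨by omega, h⟩
      rintro r ⟨hr, h⟩
      rcases hr.lt_or_eq with h' | h'
      · exact le_max_of_le_left (hP.hasRank_le_degree (by omega) h)
      · exact le_max_of_le_right h'.ge
    omega

theorem rankSucc_congr {D E : X →₀ ℤ} (h : D - E ∈ P) : rankSucc P D = rankSucc P E := by
  refine eq_of_forall_lt_iff fun k => ?_
  rw [hP.lt_rankSucc_iff, hP.lt_rankSucc_iff]
  refine forall_congr' fun F => imp_congr_right fun _ => imp_congr_right fun _ =>
    hP.isEff_congr ?_
  rwa [sub_sub_sub_cancel_right]

theorem rankSucc_le_add (D : X →₀ ℤ) {E : X →₀ ℤ} (hE : 0 ≤ E) :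
    rankSucc P D ≤ rankSucc P (D + E) := by
  refine le_of_forall_lt fun k hk => ?_
  rw [hP.lt_rankSucc_iff] at *
  intro F hF hd
  have := (hk F hF hd).add hE
  convert this using 1
  abel

theorem rankSucc_add_le (D : X →₀ ℤ) {E : X →₀ ℤ} (hE : 0 ≤ E) :
    (rankSucc P (D + E) : ℤ) ≤ rankSucc P D + degree E := by
  by_contra! hlt
  obtain ⟨n, hn⟩ := Int.eq_ofNat_of_zero_le (degree_nonneg hE)
  have h1 : rankSucc P D + n < rankSucc P (D + E) := by omega
  rw [hP.lt_rankSucc_iff] at h1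
  refine lt_irrefl (rankSucc P D) (hP.lt_rankSucc_iff.2 fun F hF hd => ?_)
  have := h1 (F + E) (add_nonneg hF hE) (by rw [degree_add, hd, hn]; simp)
  rwa [add_sub_add_right_eq_sub] at this

theorem rankSucc_eq_zero {D : X →₀ ℤ} (h : degree D < 0) : rankSucc P D = 0 := by
  by_contra hne
  have := hP.hasRank_le_degree le_rfl (hP.lt_rankSucc_iff.1 (Nat.pos_of_ne_zero hne))
  omega

/-- Riemann's inequality: were the rank smaller, removing any effective divisor of degree `rankSucc
P D` would leave degree above `N`, hence an effective class, and the rank would be larger. -/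
theorem exists_degree_sub_le : ∃ N : ℤ, ∀ D, degree D - N ≤ rankSucc P D := by
  obtain ⟨N, hN⟩ := hP.isEff
  refine ⟨N, fun D => ?_⟩
  by_contra! hlt
  refine lt_irrefl (rankSucc P D) (hP.lt_rankSucc_iff.2 fun F hF hd => hN _ ?_)
  rw [degree_sub]
  omega

/-- The rank of a divisor of large degree differs from the degree by a constant. -/
theorem exists_rankSucc_eq : ∃ M c : ℤ, ∀ D, M ≤ degree D → (rankSucc P D : ℤ) = degree D - c := by
  obtain ⟨N, hN⟩ := hP.exists_degree_sub_le
  obtain ⟨N', hN'⟩ := hP.isEff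
  obtain ⟨c, ⟨D₀, hD₀⟩, hc⟩ := Int.exists_greatest_of_bdd
    (P := fun c => ∃ D : X →₀ ℤ, degree D - rankSucc P D = c)
    ⟨N, by rintro _ ⟨D, rfl⟩; have := hN D; omega⟩ ⟨_, 0, rfl⟩
  -- `D₀` maximises degree minus `rankSucc`. Writing `D` as equivalent to `D₀ + F` with `F`
  -- effective gives `rankSucc P D ≤ degree D - c`; maximality of `c` gives the reverse.
  refine ⟨degree D₀ + N', c, fun D hD => ?_⟩
  obtain ⟨F, hF, hDF⟩ := hN' (D - D₀) (by rw [degree_sub]; omega)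
  have h1 := hc _ ⟨D, rfl⟩
  have h2 := hP.rankSucc_add_le D₀ hF
  have h3 : D - (D₀ + F) ∈ P := by rw [← sub_sub]; exact hDF
  have h4 := hP.degree_eq_of_linEquiv h3
  rw [degree_add] at h4
  rw [← hP.rankSucc_congr h3] at h2
  omega

end IsRiemann

/-! ### Rank on a vertex gluing -/

variable {Q : Set (Y →₀ ℤ)} {w : X} {z : Y} {R : Set (Wedge w z →₀ ℤ)}

/-- The divisor on the wedge given by divisors on the two summands. -/
def glueDiv (w : X) (z : Y) (D : X →₀ ℤ) (E : Y →₀ ℤ) : Wedge w z →₀ ℤ :=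
  D.mapDomain Wedge.inl + E.mapDomain Wedge.inr

theorem glueDiv_add (D D' : X →₀ ℤ) (E E' : Y →₀ ℤ) :
    glueDiv w z (D + D') (E + E') = glueDiv w z D E + glueDiv w z D' E' := by
  simp only [glueDiv, Finsupp.mapDomain_add]
  abel

theorem glueDiv_neg (D : X →₀ ℤ) (E : Y →₀ ℤ) :
    glueDiv w z (-D) (-E) = -glueDiv w z D E := by
  have h := glueDiv_add (w := w) (z := z) D (-D) E (-E)
  rw [add_neg_cancel, add_neg_cancel] at h
  have h0 : glueDiv w z (0 : X →₀ ℤ) (0 : Y →₀ ℤ) = 0 := by simp [glueDiv]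
  exact eq_neg_of_add_eq_zero_right (h.symm.trans h0)

theorem glueDiv_sub (D D' : X →₀ ℤ) (E E' : Y →₀ ℤ) :
    glueDiv w z (D - D') (E - E') = glueDiv w z D E - glueDiv w z D' E' := by
  rw [sub_eq_add_neg, sub_eq_add_neg, glueDiv_add, glueDiv_neg, sub_eq_add_neg]

theorem degree_glueDiv (D : X →₀ ℤ) (E : Y →₀ ℤ) :
    degree (glueDiv w z D E) = degree D + degree E := by
  rw [glueDiv, degree_add, degree_mapDomain, degree_mapDomain]

theorem glueDiv_nonneg {D : X →₀ ℤ} {E : Y →₀ ℤ} (hD : 0 ≤ D) (hE : 0 ≤ E) :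
    0 ≤ glueDiv w z D E :=
  add_nonneg (mapDomain_nonneg _ hD) (mapDomain_nonneg _ hE)

theorem glueDiv_shift (D : X →₀ ℤ) (E : Y →₀ ℤ) (l : ℤ) :
    glueDiv w z (D - Finsupp.single w l) (E + Finsupp.single z l) = glueDiv w z D E := by
  rw [sub_eq_add_neg, glueDiv_add, ← Finsupp.single_neg, add_eq_left, glueDiv,
    Finsupp.mapDomain_single, Finsupp.mapDomain_single, ← Wedge.glue, ← Finsupp.single_add,
    neg_add_cancel, Finsupp.single_zero]

theorem exists_glueDiv_nonneg {F : Wedge w z →₀ ℤ} (hF : 0 ≤ F) :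
    ∃ D : X →₀ ℤ, ∃ E : Y →₀ ℤ, 0 ≤ D ∧ 0 ≤ E ∧ F = glueDiv w z D E := by
  induction F using Finsupp.induction with
  | zero => exact ⟨0, 0, le_rfl, le_rfl, by simp [glueDiv]⟩
  | single_add p n F hp hn ih =>
    have hpF : F p = 0 := Finsupp.notMem_support_iff.1 hp
    have hn0 : 0 ≤ n := by simpa [hpF] using hF p
    have hF0 : 0 ≤ F := fun q => by
      by_cases hq : q = p
      · rw [hq, hpF]; rfl
      · simpa [Finsupp.single_apply, Ne.symm hq] using hF q
    obtain ⟨D, E, hD, hE, rfl⟩ := ih hF0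
    induction p using Wedge.ind with
    | h₁ x =>
      refine ⟨Finsupp.single x n + D, E, add_nonneg (Finsupp.single_nonneg.2 hn0) hD, hE, ?_⟩
      rw [glueDiv, glueDiv, Finsupp.mapDomain_add, Finsupp.mapDomain_single, add_assoc]
    | h₂ y =>
      refine ⟨D, Finsupp.single y n + E, hD, add_nonneg (Finsupp.single_nonneg.2 hn0) hE, ?_⟩
      rw [glueDiv, glueDiv, Finsupp.mapDomain_add, Finsupp.mapDomain_single]
      abel

/-- The two pieces meet in one point, so the only ambiguity in splitting a divisor is how the chips
there are shared. This is the source of the parameter `l`. -/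
theorem eq_single_of_glueDiv_eq_zero {D : X →₀ ℤ} {E : Y →₀ ℤ} (h : glueDiv w z D E = 0) :
    ∃ l : ℤ, D = Finsupp.single w l ∧ E = -Finsupp.single z l := by
  have h1 : ∀ x, x ≠ w → D x = 0 := fun x hx => by
    have := DFunLike.congr_fun h (Wedge.inl x)
    rw [glueDiv, Finsupp.add_apply, Finsupp.mapDomain_apply Wedge.inl_injective,
      Finsupp.mapDomain_of_notMem_range] at this
    · simpa using this
    · rintro ⟨y, hy⟩
      exact hx (Wedge.inl_eq_inr.1 hy.symm).1
  have h2 : ∀ y, y ≠ z → E y = 0 := fun y hy => by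
    have := DFunLike.congr_fun h (Wedge.inr y)
    rw [glueDiv, Finsupp.add_apply, Finsupp.mapDomain_apply Wedge.inr_injective,
      Finsupp.mapDomain_of_notMem_range] at this
    · simpa using this
    · rintro ⟨x, hx⟩
      exact hy (Wedge.inl_eq_inr.1 hx).2
  have h3 : D w + E z = 0 := by
    have := DFunLike.congr_fun h (Wedge.inl w)
    rwa [glueDiv, Finsupp.add_apply, Finsupp.mapDomain_apply Wedge.inl_injective, Wedge.glue,
      Finsupp.mapDomain_apply Wedge.inr_injective] at this
  refine ⟨D w, ?_, ?_⟩
  · ext x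
    by_cases hx : x = w
    · simp [hx]
    · simp [h1 x hx, Ne.symm hx]
  · ext y
    by_cases hy : y = z
    · rw [hy]; simp; omega
    · simp [h2 y hy, Ne.symm hy]

/-- `R` consists of the sums of elements of `P` and `Q`. -/
def IsGlued (P : Set (X →₀ ℤ)) (Q : Set (Y →₀ ℤ)) (R : Set (Wedge w z →₀ ℤ)) : Prop :=
  ∀ F, F ∈ R ↔ ∃ D ∈ P, ∃ E ∈ Q, F = glueDiv w z D E

theorem IsGlued.isEff_iff (hR : IsGlued P Q R) (D : X →₀ ℤ) (E : Y →₀ ℤ) :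
    IsEff R (glueDiv w z D E) ↔
      ∃ l : ℤ, IsEff P (D - Finsupp.single w l) ∧ IsEff Q (E + Finsupp.single z l) := by
  constructor
  · rintro ⟨F, hF, h⟩
    obtain ⟨A, B, hA, hB, rfl⟩ := exists_glueDiv_nonneg hF
    obtain ⟨p, hp, q, hq, h⟩ := (hR _).1 h
    rw [← glueDiv_sub, ← sub_eq_zero, ← glueDiv_sub] at h
    obtain ⟨l, h1, h2⟩ := eq_single_of_glueDiv_eq_zero h
    refine ⟨l, ⟨A, hA, ?_⟩, ⟨B, hB, ?_⟩⟩
    · unfold LinEquiv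
      rw [← h1]
      convert hp using 1
      abel
    · unfold LinEquiv
      rw [← neg_neg (Finsupp.single z l), ← h2]
      convert hq using 1
      abel
  · rintro ⟨l, ⟨A, hA, hp⟩, ⟨B, hB, hq⟩⟩
    refine ⟨glueDiv w z A B, glueDiv_nonneg hA hB, (hR _).2 ⟨_, hp, _, hq, ?_⟩⟩
    rw [glueDiv_sub, glueDiv_shift]

theorem IsRiemann.rankSucc_sub_single_antitone (hP : IsRiemann P) (D : X →₀ ℤ) (w : X) :
    Antitone fun l : ℤ => rankSucc P (D - Finsupp.single w l) := by
  intro l m hlm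
  have := hP.rankSucc_le_add (D - Finsupp.single w m)
    (E := Finsupp.single w (m - l)) (Finsupp.single_nonneg.2 (by omega))
  rwa [Finsupp.single_sub, sub_add_sub_cancel] at this

/-- The rank is antitone in `l`, is `-1` once `l` exceeds the degree, and is large for very negative
`l` by Riemann's inequality; so there is a last good `l`. -/
theorem IsRiemann.exists_greatest_hasRank (hP : IsRiemann P) (D : X →₀ ℤ) (w : X) (k : ℕ) :
    ∃ m : ℤ, ∀ l : ℤ, l ≤ m ↔ k < rankSucc P (D - Finsupp.single w l) := by
  obtain ⟨N, hN⟩ := hP.exists_degree_sub_le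
  obtain ⟨m, hm, hmax⟩ := Int.exists_greatest_of_bdd
    (P := fun l => k < rankSucc P (D - Finsupp.single w l))
    ⟨degree D, fun l hl => by
      by_contra! hlt
      rw [hP.rankSucc_eq_zero (by rw [degree_sub, degree_single]; omega)] at hl
      omega⟩
    ⟨degree D - N - k - 1, by
      have := hN (D - Finsupp.single w (degree D - N - k - 1))
      rw [degree_sub, degree_single] at this
      omega⟩
  exact ⟨m, fun l => ⟨fun h => hm.trans_le (hP.rankSucc_sub_single_antitone D w h), hmax l⟩⟩

theorem IsGlued.lt_rankSucc_iff (hP : IsRiemann P) (hQ : IsRiemann Q) (hRR : IsRiemann R)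
    (hR : IsGlued P Q R) (D : X →₀ ℤ) (E : Y →₀ ℤ) (k : ℕ) :
    k < rankSucc R (glueDiv w z D E) ↔ ∀ l : ℤ,
      k < rankSucc P (D - Finsupp.single w l) + rankSucc Q (E + Finsupp.single z (l - 1)) := by
  have hE : ∀ l : ℤ, E + Finsupp.single z l = E - Finsupp.single z (-l) := fun l => by
    rw [Finsupp.single_neg, sub_neg_eq_add]
  rw [hRR.lt_rankSucc_iff]
  constructor
  · intro h l
    by_contra! hle
    -- If the inequality fails at `l`, then `i ≤ k`, so `k - i` does not truncate, and neither piece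
    -- has the rank tested by degrees `i` and `j`. The obstructions `A` and `B` combine to one of
    -- degree `k`.
    set i := rankSucc P (D - Finsupp.single w l) with hi
    set j := k - i with hj
    have h1 : ¬ HasRank P (D - Finsupp.single w l) (i : ℤ) :=
      fun h' => lt_irrefl _ (hP.lt_rankSucc_iff.2 h')
    have h2 : ¬ HasRank Q (E + Finsupp.single z (l - 1)) (j : ℤ) := fun h' => by
      have := hQ.lt_rankSucc_iff.2 h'
      omega
    simp only [HasRank, not_forall] at h1 h2
    obtain ⟨A, hA, hdA, hAe⟩ := h1
    obtain ⟨B, hB, hdB, hBe⟩ := h2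
    have := h (glueDiv w z A B) (glueDiv_nonneg hA hB) (by rw [degree_glueDiv]; omega)
    rw [← glueDiv_sub, hR.isEff_iff] at this
    obtain ⟨m, hm1, hm2⟩ := this
    -- Any split `m` fails: for `m ≤ l - 1` the second piece has too few chips to beat `B`, for `m ≥
    -- l` the first has too few to beat `A`. This dichotomy explains the shift `l - 1`.
    rcases lt_or_ge m l with hml | hml
    · refine hBe ?_
      have := hm2.add (E := Finsupp.single z (l - 1 - m)) (Finsupp.single_nonneg.2 (by omega))
      rw [add_assoc, ← Finsupp.single_add, add_sub_cancel] at this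
      rwa [add_sub_right_comm]
    · refine hAe ?_
      have := hm1.add (E := Finsupp.single w (m - l)) (Finsupp.single_nonneg.2 (by omega))
      rw [Finsupp.single_sub, sub_add_sub_cancel] at this
      rwa [sub_right_comm]
  · intro h F hF hdF
    obtain ⟨A, B, hA, hB, rfl⟩ := exists_glueDiv_nonneg hF
    rw [degree_glueDiv] at hdF
    rw [← glueDiv_sub, hR.isEff_iff]
    obtain ⟨i, hi⟩ := Int.eq_ofNat_of_zero_le (degree_nonneg hA)
    obtain ⟨j, hj⟩ := Int.eq_ofNat_of_zero_le (degree_nonneg hB)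
    -- Give the second piece as many chips as `A` allows. At `m + 1` the first term is at most `i`,
    -- so the hypothesis there forces the second, evaluated at `m`, above `j`.
    obtain ⟨m, hm⟩ := hP.exists_greatest_hasRank D w i
    have h1 := (hm m).1 le_rfl
    have h2 : ¬ i < rankSucc P (D - Finsupp.single w (m + 1)) := fun h' => by
      have := (hm (m + 1)).2 h'
      omega
    have h3 := h (m + 1)
    rw [add_sub_cancel_right] at h3
    have h4 : j < rankSucc Q (E + Finsupp.single z m) := by omega
    refine ⟨m, ?_, ?_⟩
    · rw [sub_right_comm]
      exact hP.lt_rankSucc_iff.1 h1 A hA hi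
    · rw [← add_sub_right_comm]
      exact hQ.lt_rankSucc_iff.1 h4 B hB hj

theorem lt_tropMul_iff {s t : ℤ → ℤ → ℕ} {a b : ℤ} {k : ℕ} :
    k < tropMul s t a b ↔ ∀ l, k < s a l + t l b := by
  constructor
  · exact fun h l => h.trans_le (ciInf_le (OrderBot.bddBelow _) l)
  · intro h
    obtain ⟨l, hl⟩ := Nat.sInf_mem (range_nonempty fun l : ℤ => s a l + t l b)
    exact (h l).trans_eq hl

theorem IsGlued.transmission_eq (hP : IsRiemann P) (hQ : IsRiemann Q) (hRR : IsRiemann R)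
    (hR : IsGlued P Q R) (v : X) (y : Y) (D : X →₀ ℤ) (E : Y →₀ ℤ) :
    transmission R (Wedge.inl v) (Wedge.inr y) (glueDiv w z D E) =
      tropMul (transmission P v w D) (transmission Q z y E) := by
  funext a b
  refine eq_of_forall_lt_iff fun k => ?_
  rw [lt_tropMul_iff]
  have h1 : twist (Wedge.inl v) (Wedge.inr y) (glueDiv w z D E) (a - 1) b =
      glueDiv w z (D + Finsupp.single v (a - 1)) (E - Finsupp.single y b) := by
    rw [twist, sub_eq_add_neg E, glueDiv_add, ← Finsupp.single_neg, sub_eq_add_neg,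
      ← Finsupp.single_neg]
    simp only [glueDiv, Finsupp.mapDomain_single]
    abel
  change k < rankSucc R _ ↔ ∀ l, k < rankSucc P _ + rankSucc Q _
  rw [h1, hR.lt_rankSucc_iff hP hQ hRR]
  refine forall_congr' fun l => ?_
  rw [twist, twist, sub_add_eq_add_sub E]

end Divisors

section

/-! ### Permutations of the integers and their counting functions -/

theorem AlmostSignPreserving.finite {τ : Equiv.Perm ℤ} (h : AlmostSignPreserving τ) (a b : ℤ) :
    {n : ℤ | b ≤ n ∧ τ n < a}.Finite := by
  refine ((h.1.union (finite_Ico b 0)).union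
    ((finite_Ico 0 a).preimage (τ.injective.injOn))).subset ?_
  rintro n ⟨hb, ha⟩
  by_cases h0 : 0 ≤ n
  · by_cases h1 : τ n < 0
    · exact Or.inl (Or.inl ⟨h0, h1⟩)
    · exact Or.inr ⟨not_lt.1 h1, ha⟩
  · exact Or.inl (Or.inr ⟨hb, not_le.1 h0⟩)

theorem ncard_lt_eq_succ {p : ℤ → Prop} {b : ℤ} (hb : p b) (hf : {n : ℤ | b ≤ n ∧ p n}.Finite) :
    {n : ℤ | b ≤ n ∧ p n}.ncard = {n : ℤ | b + 1 ≤ n ∧ p n}.ncard + 1 := by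
  have h : {n : ℤ | b ≤ n ∧ p n} = insert b {n : ℤ | b + 1 ≤ n ∧ p n} := by
    ext n
    simp only [mem_ofPred_eq, mem_insert_iff]
    constructor
    · rintro ⟨h1, h2⟩
      by_cases hn : n = b
      · exact Or.inl hn
      · exact Or.inr ⟨by omega, h2⟩
    · rintro (rfl | ⟨h1, h2⟩)
      · exact ⟨le_rfl, hb⟩
      · exact ⟨by omega, h2⟩
  rw [h, ncard_insert_of_notMem (by simp) (hf.subset fun n hn => ⟨by have := hn.1; omega, hn.2⟩)]

theorem setOf_le_and_eq {p : ℤ → Prop} {b : ℤ} (hb : ¬ p b) :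
    {n : ℤ | b ≤ n ∧ p n} = {n : ℤ | b + 1 ≤ n ∧ p n} := by
  ext n
  refine ⟨fun h => ⟨?_, h.2⟩, fun h => ⟨by have := h.1; omega, h.2⟩⟩
  rcases h.1.lt_or_eq with h1 | rfl
  · omega
  · exact absurd h.2 hb

theorem ncard_lt_iff {p : ℤ → Prop} {b : ℤ} (hf : {n : ℤ | b ≤ n ∧ p n}.Finite) :
    {n : ℤ | b + 1 ≤ n ∧ p n}.ncard < {n : ℤ | b ≤ n ∧ p n}.ncard ↔ p b := by
  by_cases hb : p b
  · simp [ncard_lt_eq_succ hb hf, hb]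
  · simp [setOf_le_and_eq hb, hb]

/-- The count drops between `b` and `b + 1` exactly when the value at `b` is below `a`, so the
counts determine each value. -/
theorem perm_ext_of_ncard {σ τ : Equiv.Perm ℤ}
    (hσ : ∀ a b : ℤ, {n : ℤ | b ≤ n ∧ σ n < a}.Finite)
    (hτ : ∀ a b : ℤ, {n : ℤ | b ≤ n ∧ τ n < a}.Finite)
    (h : ∀ a b : ℤ, {n : ℤ | b ≤ n ∧ σ n < a}.ncard = {n : ℤ | b ≤ n ∧ τ n < a}.ncard) :
    σ = τ := by
  ext b
  refine eq_of_forall_gt_iff fun a => ?_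
  rw [← ncard_lt_iff (p := fun n => σ n < a) (hσ a b), h, h,
    ncard_lt_iff (p := fun n => τ n < a) (hτ a b)]

/-- A submodular function with unit steps, vanishing far to one side of the diagonal and with
nontrivial steps far to the other side, counts inversions of a permutation. -/
theorem exists_perm_of_submodular (S : ℤ → ℤ → ℕ) (M : ℤ)
    (hzero : ∀ a b, a - b ≤ -M → S a b = 0)
    (hrow : ∀ a b, S a b ≤ S (a + 1) b ∧ S (a + 1) b ≤ S a b + 1)
    (hcol : ∀ a b, S a (b + 1) ≤ S a b ∧ S a b ≤ S a (b + 1) + 1)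
    (hrow' : ∀ a b, M ≤ a - b → S (a + 1) b = S a b + 1)
    (hcol' : ∀ a b, M ≤ a - b → S a b = S a (b + 1) + 1)
    (hsub : ∀ a b, S a b + S (a + 1) (b + 1) ≤ S (a + 1) b + S a (b + 1)) :
    ∃ τ : Equiv.Perm ℤ, AlmostSignPreserving τ ∧ permCount τ = S := by
  -- Submodularity says that a drop in column `b` persists as `a` grows. The value `t b` of the
  -- permutation is the last `a` without a drop.
  have hmono : ∀ b a a', a ≤ a' → S a (b + 1) < S a b → S a' (b + 1) < S a' b := by
    intro b a a' h
    induction a', h using Int.leInduction with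
    | base => exact id
    | succ n hn ih =>
      intro h
      have h1 := ih h
      have h2 := hsub n b
      have h3 := hcol n b
      have h4 := hcol (n + 1) b
      omega
  have hjump : ∀ b, ∃ t : ℤ, ∀ a, t < a ↔ S a (b + 1) < S a b := by
    intro b
    obtain ⟨t, ht, hmax⟩ := Int.exists_greatest_of_bdd
      (P := fun a => ¬ S a (b + 1) < S a b)
      ⟨b + M, fun a ha => by
        by_contra! hlt
        have := hcol' a b (by omega)
        omega⟩
      ⟨b - M, by rw [hzero (b - M) b (by omega)]; omega⟩
    refine ⟨t, fun a => ⟨fun h => ?_, fun h => ?_⟩⟩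
    · by_contra hn
      have := hmax a hn
      omega
    · by_contra! hn
      exact ht (hmono b a t hn h)
  choose t ht using hjump
  have hge : ∀ b, b - M ≤ t b := fun b => by
    by_contra! hlt
    have := (ht b (b - M)).1 hlt
    rw [hzero (b - M) b (by omega)] at this
    omega
  have hle : ∀ b, t b < b + M := fun b => by
    have := hcol' (b + M) b (by omega)
    exact (ht b (b + M)).2 (by omega)
  have hfin : ∀ a b, {n : ℤ | b ≤ n ∧ t n < a}.Finite := fun a b =>
    (finite_Icc b (a + M)).subset fun n hn => ⟨hn.1, by have := hge n; have := hn.2; omega⟩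
  -- Both sides vanish for `b ≥ a + M` and have the same drops, so downward induction on `b`
  -- applies.
  have hcount : ∀ a b, {n : ℤ | b ≤ n ∧ t n < a}.ncard = S a b := by
    intro a
    have hbig : ∀ b, a + M ≤ b → {n : ℤ | b ≤ n ∧ t n < a}.ncard = S a b := by
      intro b hb
      rw [hzero a b (by omega), (ncard_eq_zero (hfin a b))]
      refine eq_empty_of_forall_notMem fun n hn => ?_
      have := hge n
      have h1 := hn.1
      have h2 := hn.2
      omega
    have hstep : ∀ b, {n : ℤ | b + 1 ≤ n ∧ t n < a}.ncard = S a (b + 1) →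
        {n : ℤ | b ≤ n ∧ t n < a}.ncard = S a b := by
      intro b hb
      have h1 := hcol a b
      by_cases h : t b < a
      · rw [ncard_lt_eq_succ (p := fun n => t n < a) h (hfin a b), hb]
        have := (ht b a).1 h
        omega
      · rw [setOf_le_and_eq (p := fun n => t n < a) h, hb]
        have := (not_congr (ht b a)).1 h
        omega
    intro b
    rcases le_total (a + M) b with hb | hb
    · exact hbig b hb
    · induction b, hb using Int.leInductionDown with
      | base => exact hbig _ le_rfl
      | pred n hn ih => exact hstep _ (by rwa [sub_add_cancel])
  -- A repeated value would make `S` jump by at least two in a single row step.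
  have hinj : ∀ b b', b < b' → t b ≠ t b' := by
    intro b b' hb heq
    have h1 := hrow (t b) b
    rw [← hcount, ← hcount] at h1
    have h2 : insert b (insert b' {n : ℤ | b ≤ n ∧ t n < t b}) ⊆
        {n : ℤ | b ≤ n ∧ t n < t b + 1} := by
      rintro n (rfl | rfl | ⟨h1, h2⟩)
      · exact ⟨le_rfl, by omega⟩
      · exact ⟨hb.le, by omega⟩
      · exact ⟨h1, by omega⟩
    have h3 := ncard_le_ncard h2 (hfin _ _)
    rw [ncard_insert_of_notMem (hs := (hfin _ _).insert _),
      ncard_insert_of_notMem (hs := hfin _ _)] at h3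
    · omega
    · rintro ⟨_, h⟩; omega
    · rintro (h | ⟨_, h⟩) <;> omega
  have hsurj : Function.Surjective t := by
    intro c
    -- Far from the diagonal each row step is exactly one; this increment must come from some `n`
    -- with `t n = c`.
    have h1 := hrow' c (c - M) (by omega)
    rw [← hcount, ← hcount] at h1
    by_contra! hc
    have h2 : {n : ℤ | c - M ≤ n ∧ t n < c + 1} = {n : ℤ | c - M ≤ n ∧ t n < c} := by
      ext n
      have := hc n
      simp only [mem_ofPred_eq]
      omega
    rw [h2] at h1
    omega
  have hinj' : Function.Injective t := fun b b' h => by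
    rcases lt_trichotomy b b' with h' | h' | h'
    · exact absurd h (hinj _ _ h')
    · exact h'
    · exact absurd h.symm (hinj _ _ h')
  refine ⟨Equiv.ofBijective t ⟨hinj', hsurj⟩, ⟨hfin 0 0, ?_⟩, ?_⟩
  · refine (finite_Icc 0 M).subset fun n hn => ⟨hn.1, ?_⟩
    set m := (Equiv.ofBijective t ⟨hinj', hsurj⟩)⁻¹ n with hm
    have h1 : t m = n := (Equiv.ofBijective t ⟨hinj', hsurj⟩).apply_symm_apply n
    have h2 : m < 0 := hn.2
    have := hle m
    omega
  · funext a b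
    exact hcount a b

/-! ### Transmission permutations and the abstract main result -/

variable {X : Type*} {P : Set (X →₀ ℤ)} {v w : X} {D : X →₀ ℤ}

theorem degree_twist (a b : ℤ) : degree (twist v w D a b) = degree D + a - b := by
  rw [twist, degree_sub, degree_add, degree_single, degree_single]

theorem IsRiemann.exists_perm (hP : IsRiemann P) (hD : Submodular P v w D) :
    ∃ τ : Equiv.Perm ℤ, IsTransmissionPerm P v w D τ ∧ AlmostSignPreserving τ ∧
      permCount τ = transmission P v w D := by
  obtain ⟨M, c, hM⟩ := hP.exists_rankSucc_eq
  have hS : ∀ a b, transmission P v w D a b = rankSucc P (twist v w D (a - 1) b) :=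
    fun _ _ => rfl
  have hv : ∀ a b, twist v w D (a + 1) b = twist v w D a b + Finsupp.single v 1 := fun a b => by
    simp only [twist, Finsupp.single_add]; abel
  have hw : ∀ a b, twist v w D a b = twist v w D a (b + 1) + Finsupp.single w 1 := fun a b => by
    simp only [twist, Finsupp.single_add]; abel
  have h1 : ∀ x : X, (0 : X →₀ ℤ) ≤ Finsupp.single x 1 := fun x =>
    Finsupp.single_nonneg.2 zero_le_one
  have hex : ∃ τ : Equiv.Perm ℤ, AlmostSignPreserving τ ∧ permCount τ = transmission P v w D := by
    -- The first bound keeps all divisors involved, of degree at least `degree D + a - b - 2`, in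
    -- the range where rank is degree minus a constant; the second makes the degree negative on the
    -- far side.
    refine exists_perm_of_submodular (transmission P v w D)
      (max (M + 2 - degree D) (degree D + 1)) ?_ ?_ ?_ ?_ ?_ ?_
    · intro a b hab
      rw [hS, hP.rankSucc_eq_zero]
      rw [degree_twist]
      omega
    · intro a b
      rw [hS, hS, add_sub_right_comm, hv]
      have h2 := hP.rankSucc_le_add (twist v w D (a - 1) b) (h1 v)
      have h3 := hP.rankSucc_add_le (twist v w D (a - 1) b) (h1 v)
      rw [degree_single] at h3
      omega
    · intro a b
      rw [hS, hS, hw _ b]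
      have h2 := hP.rankSucc_le_add (twist v w D (a - 1) (b + 1)) (h1 w)
      have h3 := hP.rankSucc_add_le (twist v w D (a - 1) (b + 1)) (h1 w)
      rw [degree_single] at h3
      omega
    · intro a b hab
      have h2 := hM (twist v w D (a + 1 - 1) b) (by rw [degree_twist]; omega)
      have h3 := hM (twist v w D (a - 1) b) (by rw [degree_twist]; omega)
      rw [degree_twist] at h2 h3
      rw [hS, hS]
      omega
    · intro a b hab
      have h2 := hM (twist v w D (a - 1) (b + 1)) (by rw [degree_twist]; omega)
      have h3 := hM (twist v w D (a - 1) b) (by rw [degree_twist]; omega)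
      rw [degree_twist] at h2 h3
      rw [hS, hS]
      omega
    · intro a b
      have h2 := hD a b
      have e1 : twist v w D a b - Finsupp.single v 1 = twist v w D (a - 1) b := by
        rw [sub_eq_iff_eq_add, ← hv, sub_add_cancel]
      have e2 : ∀ a, twist v w D a b - Finsupp.single w 1 = twist v w D a (b + 1) := fun a => by
        rw [sub_eq_iff_eq_add, ← hw]
      rw [rankDelta, e1, e2, e2] at h2
      have r := fun E => hP.rankSucc_eq E
      have r1 := r (twist v w D a b)
      have r2 := r (twist v w D (a - 1) b)
      have r3 := r (twist v w D a (b + 1))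
      have r4 := r (twist v w D (a - 1) (b + 1))
      rw [hS, hS, hS, hS, add_sub_cancel_right]
      omega
  obtain ⟨τ, hτ, hc⟩ := hex
  refine ⟨τ, ⟨fun a b => ?_, fun τ' hτ' => ?_⟩, hτ, hc⟩
  · have hle : ∀ n, τ n ≤ a ↔ τ n < a + 1 := fun n => Int.lt_add_one_iff.symm
    simp only [hle]
    refine ⟨hτ.finite _ _, ?_⟩
    rw [← hP.rankSucc_eq]
    have := congrFun (congrFun hc (a + 1)) b
    rw [hS, add_sub_cancel_right] at this
    rw [← this]
    rfl
  · have hle : ∀ a, ∀ σ : Equiv.Perm ℤ, ∀ n, σ n < a ↔ σ n ≤ a - 1 := fun a σ n => by omega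
    refine perm_ext_of_ncard (fun a b => ?_) hτ.finite fun a b => ?_
    · simpa only [hle] using (hτ' (a - 1) b).1
    · have h2 := (hτ' (a - 1) b).2
      rw [← hP.rankSucc_eq, ← hS, ← hc] at h2
      simp only [← hle] at h2
      exact (Nat.cast_injective h2).symm

/-- The main result for abstract groups of principal divisors. -/
theorem IsGlued.main {Y : Type*} {Q : Set (Y →₀ ℤ)} {z y : Y} {E : Y →₀ ℤ}
    {R : Set (Wedge w z →₀ ℤ)} (hP : IsRiemann P) (hQ : IsRiemann Q) (hRR : IsRiemann R)
    (hR : IsGlued P Q R) :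
    transmission R (Wedge.inl v) (Wedge.inr y) (glueDiv w z D E)
        = tropMul (transmission P v w D) (transmission Q z y E) ∧
      (Submodular P v w D → Submodular Q z y E →
        Submodular R (Wedge.inl v) (Wedge.inr y) (glueDiv w z D E) →
        ∃ τ₁ τ₂ τ : Equiv.Perm ℤ,
          IsTransmissionPerm P v w D τ₁ ∧
          IsTransmissionPerm Q z y E τ₂ ∧
          IsTransmissionPerm R (Wedge.inl v) (Wedge.inr y) (glueDiv w z D E) τ ∧
          IsDemazureProduct τ₁ τ₂ τ) := by
  refine ⟨hR.transmission_eq hP hQ hRR v y D E, fun h1 h2 h3 => ?_⟩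
  obtain ⟨τ₁, ht1, hs1, hc1⟩ := hP.exists_perm h1
  obtain ⟨τ₂, ht2, hs2, hc2⟩ := hQ.exists_perm h2
  obtain ⟨τ, ht, hs, hc⟩ := hRR.exists_perm h3
  have heq : permCount τ = tropMul (permCount τ₁) (permCount τ₂) := by
    rw [hc, hc1, hc2, hR.transmission_eq hP hQ hRR v y D E]
  refine ⟨τ₁, τ₂, τ, ht1, ht2, ht, hs1, hs2, hs, heq, fun τ' hs' h' => ?_⟩
  refine perm_ext_of_ncard hs'.finite hs.finite fun a b => ?_
  exact congrFun (congrFun (h'.trans heq.symm) a) b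

end

/-! ### The Laplacian of a weighted graph -/

/-- Duality and the Dirichlet form: a functional vanishing on the range of `L`, viewed as a function
`g` on vertices, has zero energy. By connectedness `g` is constant, so the functional also kills
every `D` of total zero. -/
theorem exists_laplacian_eq {V J : Type*} [Fintype V] [DecidableEq V] [Fintype J] (s t : J → V) (c : J → ℝ)
    (hc : ∀ j, 0 < c j)
    (hconn : ∀ g : V → ℝ, (∀ j, g (s j) = g (t j)) → ∀ x y, g x = g y)
    (D : V → ℝ) (hD : ∑ x, D x = 0) :
    ∃ f : V → ℝ, ∀ x, ∑ j, c j * (f (t j) - f (s j)) *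
      ((if s j = x then 1 else 0) - (if t j = x then 1 else 0)) = D x := by
  let L : (V → ℝ) →ₗ[ℝ] (V → ℝ) :=
    { toFun := fun f => ∑ j, (c j * (f (t j) - f (s j))) •
        (Pi.single (s j) 1 - Pi.single (t j) 1)
      map_add' := fun f g => by
        rw [← Finset.sum_add_distrib]
        refine Finset.sum_congr rfl fun j _ => ?_
        rw [← add_smul]
        congr 1
        simp only [Pi.add_apply]
        ring
      map_smul' := fun r f => by
        rw [Finset.smul_sum]
        refine Finset.sum_congr rfl fun j _ => ?_
        rw [smul_smul]
        congr 1
        simp only [Pi.smul_apply, smul_eq_mul, RingHom.id_apply]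
        ring }
  have hL : ∀ f, L f = ∑ j, (c j * (f (t j) - f (s j))) •
        (Pi.single (s j) 1 - Pi.single (t j) 1) := fun _ => rfl
  suffices h : D ∈ LinearMap.range L by
    obtain ⟨f, rfl⟩ := h
    refine ⟨f, fun x => ?_⟩
    rw [hL, Finset.sum_apply]
    refine Finset.sum_congr rfl fun j _ => ?_
    simp [Pi.single_apply, eq_comm]
  by_contra hn
  obtain ⟨φ, hφ, hle⟩ := Submodule.exists_le_ker_of_notMem hn
  let g : V → ℝ := fun x => φ (Pi.single x 1)
  have h0 : φ (L g) = 0 := hle ⟨g, rfl⟩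
  have h1 : φ (L g) = ∑ j, -(c j * (g (t j) - g (s j)) ^ 2) := by
    rw [hL, map_sum]
    refine Finset.sum_congr rfl fun j _ => ?_
    rw [map_smul, map_sub, smul_eq_mul]
    change c j * (g (t j) - g (s j)) * (g (s j) - g (t j)) = _
    ring
  rw [h0, Finset.sum_neg_distrib, eq_comm, neg_eq_zero, Finset.sum_eq_zero_iff_of_nonneg
    fun j _ => mul_nonneg (hc j).le (sq_nonneg _)] at h1
  have hg := hconn g fun j => by
    have := h1 j (Finset.mem_univ j)
    rw [mul_eq_zero, or_iff_right (hc j).ne', sq_eq_zero_iff, sub_eq_zero] at this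
    exact this.symm
  refine hφ ?_
  have hDs : D = ∑ x, D x • (Pi.single x 1 : V → ℝ) := by
    funext y
    simp [Finset.sum_apply, Pi.single_apply]
  rw [hDs, map_sum]
  simp only [map_smul, smul_eq_mul]
  change ∑ x, D x * g x = 0
  rcases isEmpty_or_nonempty V with hV | ⟨⟨q⟩⟩
  · simp
  · rw [Finset.sum_congr rfl fun x _ => by rw [hg x q], ← Finset.sum_mul, hD, zero_mul]

/-! ### Finite graphs -/

namespace FiniteGraph

variable {V E : Type*} (G : FiniteGraph V E)

theorem exists_orientation : ∃ s t : G.edgeSet → V, ∀ e : G.edgeSet, G.IsLink e (s e) (t e) := by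
  have h : ∀ e : G.edgeSet, ∃ p : V × V, G.IsLink e p.1 p.2 := fun e => by
    obtain ⟨x, y, h⟩ := G.exists_isLink_of_mem_edgeSet e.2
    exact ⟨⟨x, y⟩, h⟩
  choose p hp using h
  exact ⟨fun e => (p e).1, fun e => (p e).2, hp⟩

variable {G}

open Classical in
-- Grouping the Laplacian by oriented edges instead of by neighbours; in this form it splits over a
-- disjoint union of edge sets, as gluing requires.
theorem mem_principal_iff {J : Type*} [Fintype J] (ε : J → E) (hε : Function.Injective ε)
    (hε' : ∀ e ∈ G.edgeSet, ∃ j, ε j = e) (s t : J → V)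
    (hl : ∀ j, G.IsLink (ε j) (s j) (t j)) (D : V →₀ ℤ) :
    D ∈ G.principal ↔ ∃ f : V → ℤ, D = ∑ j, (Finsupp.single (s j) (f (t j) - f (s j)) -
      Finsupp.single (t j) (f (t j) - f (s j))) := by
  have := G.finite_vertices
  have := Fintype.ofFinite V
  refine exists_congr fun f => ?_
  rw [DFunLike.ext_iff]
  refine forall_congr' fun x => ?_
  suffices h : ∑ᶠ y : V, ({e : E | G.IsLink e x y}.ncard : ℤ) * (f y - f x) =
      (∑ j, (Finsupp.single (s j) (f (t j) - f (s j)) -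
        Finsupp.single (t j) (f (t j) - f (s j)))) x by rw [h]
  rw [finsum_eq_sum_of_fintype, Finsupp.finsetSum_apply]
  have hcard : ∀ y, ({e : E | G.IsLink e x y}.ncard : ℤ) =
      ∑ j, if G.IsLink (ε j) x y then 1 else 0 := by
    intro y
    have h : {e : E | G.IsLink e x y} = ε '' {j | G.IsLink (ε j) x y} := by
      ext e
      constructor
      · intro h
        obtain ⟨j, rfl⟩ := hε' e h.edge_mem
        exact ⟨j, h, rfl⟩
      · rintro ⟨j, h, rfl⟩
        exact h
    rw [h, ncard_image_of_injective _ hε, Finset.sum_boole, ← ncard_coe_finset]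
    simp
  simp only [hcard, Finset.sum_mul]
  rw [Finset.sum_comm]
  refine Finset.sum_congr rfl fun j _ => ?_
  have hne : s j ≠ t j := fun h => G.loopless (ε j) (s j) (by have := hl j; rwa [← h] at this)
  have hiff : ∀ y, G.IsLink (ε j) x y ↔ (s j = x ∧ t j = y) ∨ (s j = y ∧ t j = x) := fun y =>
    (hl j).isLink_iff
  simp only [hiff, Finsupp.sub_apply, Finsupp.single_apply]
  by_cases h1 : s j = x
  · subst h1
    simp [hne.symm]
  · by_cases h2 : t j = x
    · subst h2
      simp [h1]
    · simp [h1, h2]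

variable (G)

theorem isRiemann (q : V) : IsRiemann G.principal := by
  classical
  have := G.finite_vertices
  have := Fintype.ofFinite V
  have : Fintype G.edgeSet := G.finite_edges.fintype
  obtain ⟨s, t, hst⟩ := G.exists_orientation
  have hmem := mem_principal_iff (G := G) (fun e : G.edgeSet => (e : E)) Subtype.val_injective
    (fun e he => ⟨⟨e, he⟩, rfl⟩) s t hst
  refine ⟨⟨q⟩, fun D hD D' hD' => ?_, fun D hD => ?_, fun D hD => ?_,
    2 * Fintype.card G.edgeSet, fun D hD => ?_⟩
  · rw [hmem] at *
    obtain ⟨f, rfl⟩ := hD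
    obtain ⟨g, rfl⟩ := hD'
    refine ⟨f + g, ?_⟩
    rw [← Finset.sum_add_distrib]
    refine Finset.sum_congr rfl fun j _ => ?_
    simp only [Pi.add_apply, add_sub_add_comm, Finsupp.single_add]
  · rw [hmem] at *
    obtain ⟨f, rfl⟩ := hD
    refine ⟨-f, ?_⟩
    rw [← Finset.sum_neg_distrib]
    refine Finset.sum_congr rfl fun j _ => ?_
    simp only [Pi.neg_apply, Finsupp.single_neg, Finsupp.single_sub]
    abel
  · obtain ⟨f, rfl⟩ := (hmem D).1 hD
    rw [degree_sum]
    simp only [degree_sub, degree_single, sub_self, Finset.sum_const_zero]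
  · have hdeg : ∑ x, D x = degree D := 
      (Finsupp.sum_fintype D (fun _ n => n) fun _ => rfl).symm
    -- The target is `D` with one chip reserved at each end of each edge and the remaining surplus
    -- reserved at `q`, so its total is zero. Taking floors changes the slope along an edge by less
    -- than one, which the reserved chips absorb.
    obtain ⟨f, hf⟩ := exists_laplacian_eq s t (fun _ => 1) (fun _ => one_pos)
      (fun g hg x y => by
        induction G.connected x y with
        | refl => rfl
        | tail _ h ih =>
          obtain ⟨e, h⟩ := h
          have h' := hst ⟨e, h.edge_mem⟩
          rcases h'.isLink_iff.1 h with ⟨h1, h2⟩ | ⟨h1, h2⟩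
          · exact ih.trans ((congrArg g h1).symm.trans ((hg _).trans (congrArg g h2)))
          · exact ih.trans ((congrArg g h2).symm.trans ((hg _).symm.trans (congrArg g h1))))
      (fun x => D x - (∑ j, ((if s j = x then 1 else 0) + (if t j = x then 1 else 0))) -
        (if q = x then (degree D - 2 * Fintype.card G.edgeSet : ℝ) else 0)) (by
          rw [Finset.sum_sub_distrib, Finset.sum_sub_distrib, Finset.sum_comm, ← hdeg]
          simp [Finset.sum_add_distrib]
          ring)
    have hp := (hmem _).2 ⟨fun x => ⌊f x⌋, rfl⟩
    refine ⟨D - ∑ j, (Finsupp.single (s j) (⌊f (t j)⌋ - ⌊f (s j)⌋) -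
      Finsupp.single (t j) (⌊f (t j)⌋ - ⌊f (s j)⌋)), fun x => ?_, ?_⟩
    rotate_left
    · unfold LinEquiv
      rw [sub_sub_cancel]
      exact hp
    · have hx := hf x
      rw [Finsupp.coe_zero, Pi.zero_apply, ← Int.cast_le (R := ℝ), Finsupp.sub_apply,
        Finsupp.finsetSum_apply, Int.cast_zero, Int.cast_sub, Int.cast_sum]
      have hq : 0 ≤ (if q = x then (degree D - 2 * Fintype.card G.edgeSet : ℝ) else 0) := by
        split_ifs
        · have : ((2 * Fintype.card G.edgeSet : ℤ) : ℝ) ≤ degree D := Int.cast_le.2 hD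
          push_cast at this
          linarith
        · exact le_rfl
      have hle : ∑ j, (((Finsupp.single (s j) (⌊f (t j)⌋ - ⌊f (s j)⌋) -
          Finsupp.single (t j) (⌊f (t j)⌋ - ⌊f (s j)⌋) : V →₀ ℤ) x : ℤ) : ℝ) ≤
          ∑ j, (1 * (f (t j) - f (s j)) *
            ((if s j = x then 1 else 0) - (if t j = x then 1 else 0)) +
            ((if s j = x then 1 else 0) + (if t j = x then 1 else 0))) := by
        refine Finset.sum_le_sum fun j _ => ?_
        have h1 := Int.floor_le (f (t j))
        have h2 := Int.lt_floor_add_one (f (t j))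
        have h3 := Int.floor_le (f (s j))
        have h4 := Int.lt_floor_add_one (f (s j))
        simp only [Finsupp.sub_apply, Finsupp.single_apply]
        split_ifs <;> push_cast <;> linarith
      rw [Finset.sum_add_distrib, hx] at hle
      linarith

variable {V' E' : Type*} (H : FiniteGraph V' E')

theorem isGlued (w : V) (z : V') :
    IsGlued G.principal H.principal (G.vertexGluing H w z).principal := by
  have : Fintype G.edgeSet := G.finite_edges.fintype
  have : Fintype H.edgeSet := H.finite_edges.fintype
  obtain ⟨s, t, hst⟩ := G.exists_orientation
  obtain ⟨s', t', hst'⟩ := H.exists_orientation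
  have hG := mem_principal_iff (G := G) (fun e : G.edgeSet => (e : E)) Subtype.val_injective
    (fun e he => ⟨⟨e, he⟩, rfl⟩) s t hst
  have hH := mem_principal_iff (G := H) (fun e : H.edgeSet => (e : E')) Subtype.val_injective
    (fun e he => ⟨⟨e, he⟩, rfl⟩) s' t' hst'
  have hGH := mem_principal_iff (G := G.vertexGluing H w z)
    (Sum.map (fun e : G.edgeSet => (e : E)) fun e : H.edgeSet => (e : E'))
    (Subtype.val_injective.sumMap Subtype.val_injective)
    (by
      intro e he
      obtain ⟨x, y, h⟩ := Graph.exists_isLink_of_mem_edgeSet he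
      rcases e with e | e <;> obtain ⟨a, b, h, -, -⟩ := h
      · exact ⟨Sum.inl ⟨e, h.edge_mem⟩, rfl⟩
      · exact ⟨Sum.inr ⟨e, h.edge_mem⟩, rfl⟩)
    (Sum.elim (fun e => Wedge.inl (s e)) fun e => Wedge.inr (s' e))
    (Sum.elim (fun e => Wedge.inl (t e)) fun e => Wedge.inr (t' e))
    (by
      rintro (e | e)
      · exact ⟨_, _, hst e, rfl, rfl⟩
      · exact ⟨_, _, hst' e, rfl, rfl⟩)
  have hmap : ∀ (f : V → ℤ) (g : V' → ℤ),
      glueDiv w z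
        (∑ j, (Finsupp.single (s j) (f (t j) - f (s j)) -
          Finsupp.single (t j) (f (t j) - f (s j))))
        (∑ j, (Finsupp.single (s' j) (g (t' j) - g (s' j)) -
          Finsupp.single (t' j) (g (t' j) - g (s' j)))) =
      (∑ j, (Finsupp.single (Wedge.inl (s j)) (f (t j) - f (s j)) -
          Finsupp.single (Wedge.inl (t j)) (f (t j) - f (s j)))) +
        ∑ j, (Finsupp.single (Wedge.inr (s' j)) (g (t' j) - g (s' j)) -
          Finsupp.single (Wedge.inr (t' j)) (g (t' j) - g (s' j))) := by
    intro f g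
    simp only [glueDiv, Finsupp.mapDomain_finsetSum, Finsupp.mapDomain_sub,
      Finsupp.mapDomain_single]
  intro F
  rw [hGH]
  simp only [Fintype.sum_sum_type, Sum.elim_inl, Sum.elim_inr]
  constructor
  · rintro ⟨f, rfl⟩
    exact ⟨_, (hG _).2 ⟨fun x => f (Wedge.inl x), rfl⟩, _,
      (hH _).2 ⟨fun y => f (Wedge.inr y), rfl⟩,
      (hmap (fun x => f (Wedge.inl x)) fun y => f (Wedge.inr y)).symm⟩
  · rintro ⟨D, hD, D', hD', rfl⟩
    obtain ⟨f, rfl⟩ := (hG D).1 hD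
    obtain ⟨g, rfl⟩ := (hH D').1 hD'
    -- Adding a constant to `g` does not change its divisor and makes the two functions agree at the
    -- glued point.
    refine ⟨Quot.lift (Sum.elim f fun y => g y - g z + f w) ?_, ?_⟩
    · rintro _ _ ⟨rfl, rfl⟩
      simp
    · rw [hmap]
      simp [Wedge.inl, Wedge.inr]

end FiniteGraph

/-! ### Piecewise linear functions on an interval -/

section Interval

variable {L : ℝ}

/-- The value at `t` of the piecewise linear function `∑ d(s) (t - s)⁺`. -/
def plEval (t : ℝ) : (Icc (0 : ℝ) L →₀ ℤ) →+ ℝ :=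
  Finsupp.liftAddHom fun s => (AddMonoidHom.mulRight (max (t - s) 0)).comp (Int.castAddHom ℝ)

/-- The first moment `∑ d(s) s` of a divisor on an interval. -/
def moment : (Icc (0 : ℝ) L →₀ ℤ) →+ ℝ :=
  Finsupp.liftAddHom fun s => (AddMonoidHom.mulRight (s : ℝ)).comp (Int.castAddHom ℝ)

theorem plEval_apply (t : ℝ) (d : Icc (0 : ℝ) L →₀ ℤ) :
    plEval t d = d.sum fun s n => (n : ℝ) * max (t - s) 0 := rfl

theorem moment_apply (d : Icc (0 : ℝ) L →₀ ℤ) : moment d = d.sum fun s n => (n : ℝ) * s := rfl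

theorem plEval_single (t : ℝ) (s : Icc (0 : ℝ) L) (n : ℤ) :
    plEval t (Finsupp.single s n) = n * max (t - s) 0 := by
  simp [plEval]

theorem moment_single (s : Icc (0 : ℝ) L) (n : ℤ) :
    moment (Finsupp.single s n) = n * (s : ℝ) := by
  simp [moment]

theorem plEval_eq_zero {t : ℝ} {d : Icc (0 : ℝ) L →₀ ℤ} (h : ∀ s, d s ≠ 0 → t ≤ s) :
    plEval t d = 0 := by
  rw [plEval_apply]
  refine Finset.sum_eq_zero fun s hs => ?_
  have := h s (Finsupp.mem_support_iff.1 hs)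
  change (d s : ℝ) * max (t - s) 0 = 0
  rw [max_eq_right (by linarith), mul_zero]

/-- To the right of the support every positive part is linear. In degree zero the value is minus the
moment, so moments prescribe increments. -/
theorem plEval_eq_of_le {t : ℝ} {d : Icc (0 : ℝ) L →₀ ℤ} (h : ∀ s, d s ≠ 0 → (s : ℝ) ≤ t) :
    plEval t d = degree d * t - moment d := by
  rw [plEval_apply, moment_apply, degree, Finsupp.sum, Finsupp.sum, Finsupp.sum, Int.cast_sum,
    Finset.sum_mul, ← Finset.sum_sub_distrib]
  refine Finset.sum_congr rfl fun s hs => ?_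
  have := h s (Finsupp.mem_support_iff.1 hs)
  rw [max_eq_left (by linarith), mul_sub]

theorem plEval_zero (d : Icc (0 : ℝ) L →₀ ℤ) : plEval 0 d = 0 :=
  plEval_eq_zero fun s _ => s.2.1

/-- Every point between the ends of a subdivision is the first point or lies in an interval. -/
theorem exists_mem_Icc_castSucc_succ {α : Type*} [LinearOrder α] {n : ℕ} (t : Fin (n + 1) → α)
    {s : α} (h0 : t 0 ≤ s) (h1 : s ≤ t (Fin.last n)) :
    s = t 0 ∨ ∃ i : Fin n, s ∈ Icc (t i.castSucc) (t i.succ) := by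
  have key : ∀ k : Fin (n + 1), s ≤ t k →
      s = t 0 ∨ ∃ i : Fin n, s ∈ Icc (t i.castSucc) (t i.succ) := by
    intro k
    induction k using Fin.induction with
    | zero => exact fun h => Or.inl (le_antisymm h h0)
    | succ i ih =>
      intro h
      rcases le_total s (t i.castSucc) with h' | h'
      · exact ih h'
      · exact Or.inr ⟨i, h', h⟩
  exact key _ h1

/-- The slope of `plEval` on the intervals of a subdivision. -/
theorem plEval_sum_eq {n : ℕ} {t : Fin (n + 1) → Icc (0 : ℝ) L} (ht : Monotone t) (m : Fin n → ℤ)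
    (j : Fin n) {s : Icc (0 : ℝ) L} (hs : s ∈ Icc (t j.castSucc) (t j.succ)) :
    plEval s (∑ i : Fin n, (Finsupp.single (t i.castSucc) (m i) -
      Finsupp.single (t i.succ) (m i))) =
    plEval (t j.castSucc) (∑ i : Fin n, (Finsupp.single (t i.castSucc) (m i) -
      Finsupp.single (t i.succ) (m i))) + (m j : ℝ) * ((s : ℝ) - (t j.castSucc : ℝ)) := by
  have hs1 : (t j.castSucc : ℝ) ≤ s := hs.1
  have hs2 : (s : ℝ) ≤ t j.succ := hs.2
  rw [map_sum, map_sum, ← sub_eq_iff_eq_add', ← Finset.sum_sub_distrib,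
    Finset.sum_eq_single j]
  · simp only [map_sub, plEval_single]
    rw [max_eq_left (by linarith), max_eq_right (a := (s : ℝ) - _) (by linarith),
      max_eq_right (by linarith), max_eq_right (by linarith)]
    ring
  · intro i _ hij
    have h1 : (t i.castSucc : ℝ) ≤ t i.succ := ht i.castSucc_le_succ
    simp only [map_sub, plEval_single]
    rcases lt_or_gt_of_ne hij with h | h
    · have h2 : (t i.succ : ℝ) ≤ t j.castSucc := ht (Fin.succ_le_castSucc_iff.2 h)
      rw [max_eq_left (by linarith), max_eq_left (by linarith), max_eq_left (by linarith),
        max_eq_left (by linarith)]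
      ring
    · have h2 : (t j.succ : ℝ) ≤ t i.castSucc := ht (Fin.succ_le_castSucc_iff.2 h)
      rw [max_eq_right (by linarith), max_eq_right (by linarith), max_eq_right (by linarith),
        max_eq_right (by linarith)]
      ring
  · simp

/-- Summation by parts: the slopes `m` are the partial sums of `c`. -/
theorem exists_sum_single_eq {α : Type*} {n : ℕ} (t : Fin (n + 1) → α) (c : Fin (n + 1) → ℤ) :
    ∃ m : Fin n → ℤ, ∑ i, Finsupp.single (t i) (c i) =
      ∑ i : Fin n, (Finsupp.single (t i.castSucc) (m i) - Finsupp.single (t i.succ) (m i)) +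
        Finsupp.single (t (Fin.last n)) (∑ i, c i) := by
  induction n with
  | zero => exact ⟨Fin.elim0, by simp⟩
  | succ n ih =>
    obtain ⟨m, hm⟩ := ih (fun i => t i.castSucc) fun i => c i.castSucc
    rw [Fin.sum_univ_castSucc (f := fun i => Finsupp.single (t i) (c i)), hm,
      Fin.sum_univ_castSucc (f := c)]
    generalize ∑ i : Fin (n + 1), c i.castSucc = C
    refine ⟨Fin.snoc m C, ?_⟩
    rw [Fin.sum_univ_castSucc]
    simp only [Fin.snoc_castSucc, Fin.snoc_last, Finsupp.single_add, Fin.succ_last,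
      Fin.succ_castSucc]
    abel

theorem exists_subdivision (hL : 0 ≤ L) (W : Finset (Icc (0 : ℝ) L)) :
    ∃ (n : ℕ) (t : Fin (n + 1) → Icc (0 : ℝ) L), StrictMono t ∧ (t 0 : ℝ) = 0 ∧
      (t (Fin.last n) : ℝ) = L ∧ ∀ s ∈ W, s ∈ range t := by
  classical
  let a : Icc (0 : ℝ) L := ⟨0, le_rfl, hL⟩
  let b : Icc (0 : ℝ) L := ⟨L, hL, le_rfl⟩
  let W' := insert a (insert b W)
  obtain ⟨n, hn⟩ := Nat.exists_eq_succ_of_ne_zero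
    (Finset.card_ne_zero_of_mem (Finset.mem_insert_self a (insert b W)))
  have hr : ∀ s ∈ W', s ∈ range (W'.orderEmbOfFin hn) := fun s hs => by
    rw [Finset.range_orderEmbOfFin]; exact hs
  have hmono := (W'.orderEmbOfFin hn).strictMono
  refine ⟨n, W'.orderEmbOfFin hn, hmono, ?_, ?_, fun s hs => hr s (by simp [W', hs])⟩
  · obtain ⟨k, hk⟩ := hr a (by simp [W'])
    have : W'.orderEmbOfFin hn 0 ≤ a := hk ▸ hmono.monotone (Fin.zero_le k)
    exact le_antisymm this (W'.orderEmbOfFin hn 0).2.1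
  · obtain ⟨k, hk⟩ := hr b (by simp [W'])
    have : b ≤ W'.orderEmbOfFin hn (Fin.last n) := hk ▸ hmono.monotone (Fin.le_last k)
    exact le_antisymm (W'.orderEmbOfFin hn (Fin.last n)).2.2 this

/-- A piecewise linear function is recovered from its initial value and its divisor, so subdivisions
disappear and the condition becomes linear in `g` and `d`. The coefficient at the right end does not
affect `plEval` on the interval; degree zero fixes it. -/
theorem isDivOn_iff (hL : 0 ≤ L) {g : Icc (0 : ℝ) L → ℝ} {d : Icc (0 : ℝ) L →₀ ℤ} :
    IsDivOn g d ↔ degree d = 0 ∧ ∀ t, g t = g ⟨0, le_rfl, hL⟩ + plEval t d := by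
  constructor
  · rintro ⟨n, t, m, ht, h0, h1, hg, rfl⟩
    refine ⟨?_, fun s => ?_⟩
    · rw [degree_sum]
      simp [degree_sub, degree_single]
    set d := ∑ i : Fin n, (Finsupp.single (t i.castSucc) (m i) - Finsupp.single (t i.succ) (m i))
    have ht0 : t 0 = ⟨0, le_rfl, hL⟩ := Subtype.ext h0
    have hstep : ∀ j : Fin n, ∀ s ∈ Icc (t j.castSucc) (t j.succ),
        g s - plEval s d = g (t j.castSucc) - plEval (t j.castSucc) d := by
      intro j s hs
      rw [hg j s hs, plEval_sum_eq ht m j hs]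
      ring
    have hnode : ∀ k, g (t k) - plEval (t k) d = g (t 0) - plEval (t 0) d := by
      intro k
      induction k using Fin.induction with
      | zero => rfl
      | succ j ih => rw [hstep j _ ⟨ht j.castSucc_le_succ, le_rfl⟩, ih]
    have hs : g s - plEval s d = g (t 0) - plEval (t 0) d := by
      rcases exists_mem_Icc_castSucc_succ t (s := s) (by rw [ht0]; exact s.2.1)
        (by rw [← Subtype.coe_le_coe, h1]; exact s.2.2) with rfl | ⟨i, hi⟩
      · rfl
      · rw [hstep i s hi, hnode]
    rw [h0, plEval_zero, ht0] at hs
    linarith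
  · rintro ⟨hd, hg⟩
    obtain ⟨n, t, ht, h0, h1, hW⟩ := exists_subdivision hL d.support
    obtain ⟨m, hm⟩ := exists_sum_single_eq t fun i => d (t i)
    have hdt : d = ∑ i, Finsupp.single (t i) (d (t i)) := by
      ext s
      rw [Finsupp.finsetSum_apply]
      by_cases hs : d s = 0
      · rw [hs, eq_comm]
        refine Finset.sum_eq_zero fun i _ => ?_
        by_cases hi : t i = s
        · simp [hi, hs]
        · simp [hi]
      · obtain ⟨k, rfl⟩ := hW s (Finsupp.mem_support_iff.2 hs)
        rw [Finset.sum_eq_single k]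
        · simp
        · intro i _ hi
          simp [ht.injective.ne hi]
        · simp
    have hsum : ∑ i, d (t i) = 0 := by
      rw [hdt, degree_sum] at hd
      simpa only [degree_single] using hd
    rw [← hdt, hsum, Finsupp.single_zero, add_zero] at hm
    refine ⟨n, t, m, ht.monotone, h0, h1, fun i s hs => ?_, hm⟩
    rw [hg, hg (t i.castSucc), hm, plEval_sum_eq ht.monotone m i hs]
    ring

/-- A divisor on a segment `[a, b]` is equivalent, up to a function with prescribed increment
`c` along the segment, to a single chip and chips at the ends. -/
theorem exists_segment_divisor {a b : Icc (0 : ℝ) L} (hab : a < b) {d : Icc (0 : ℝ) L →₀ ℤ}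
    (hd : ∀ s, d s ≠ 0 → s ∈ Icc a b) (c : ℝ) :
    ∃ (u : Icc (0 : ℝ) L) (α β : ℤ) (δ : Icc (0 : ℝ) L →₀ ℤ),
      d + δ = Finsupp.single u 1 + Finsupp.single a α + Finsupp.single b β ∧
      degree δ = 0 ∧ (∀ s : Icc (0 : ℝ) L, s ≤ a → plEval s δ = 0) ∧
      (∀ s : Icc (0 : ℝ) L, b ≤ s → plEval s δ = c) ∧
      degree d - (moment d - degree d * a - c) / (b - a) - 1 ≤ α ∧
      (moment d - degree d * a - c) / (b - a) - 1 ≤ β := by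
  have hab' : (0 : ℝ) < b - a := sub_pos.2 hab
  -- If all `degree d` chips sat at `a` and `b`, the increment `c` would require `ρ` of them at `b`.
  -- The integer part stays at `b`; a single chip at `u` realises the fractional part.
  set ρ := (moment d - degree d * a - c) / (b - a) with hρ
  have hf := Int.floor_le ρ
  have hf' := Int.lt_floor_add_one ρ
  have hle : (a : ℝ) ≤ a + (ρ - ⌊ρ⌋) * (b - a) := by nlinarith
  have hle' : a + (ρ - ⌊ρ⌋) * (b - a) ≤ (b : ℝ) := by nlinarith
  let u : Icc (0 : ℝ) L := ⟨a + (ρ - ⌊ρ⌋) * (b - a), a.2.1.trans hle, hle'.trans b.2.2⟩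
  have hu : u ∈ Icc a b := ⟨hle, hle'⟩
  let δ : Icc (0 : ℝ) L →₀ ℤ := Finsupp.single u 1 + Finsupp.single a (degree d - 1 - ⌊ρ⌋) +
    Finsupp.single b ⌊ρ⌋ - d
  have hδ : ∀ s, δ s ≠ 0 → s ∈ Icc a b := by
    intro s hs
    by_contra hn
    have h1 : d s = 0 := by
      by_contra h
      exact hn (hd s h)
    have h2 : u ≠ s := fun h => hn (h ▸ hu)
    have h3 : a ≠ s := fun h => hn (h ▸ left_mem_Icc.2 hab.le)
    have h4 : b ≠ s := fun h => hn (h ▸ right_mem_Icc.2 hab.le)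
    exact hs (by simp [δ, h1, h2, h3, h4])
  have hdeg : degree δ = 0 := by
    simp only [δ, degree_sub, degree_add, degree_single]
    ring
  have hmom : moment δ = -c := by
    simp only [δ, map_sub, map_add, moment_single, u]
    have : ρ * (b - a) = moment d - degree d * a - c := div_mul_cancel₀ _ hab'.ne'
    push_cast
    linear_combination this
  refine ⟨u, degree d - 1 - ⌊ρ⌋, ⌊ρ⌋, δ, add_sub_cancel _ _, hdeg, fun s hs => ?_, fun s hs => ?_,
    ?_, ?_⟩
  · exact plEval_eq_zero fun x hx => hs.trans (hδ x hx).1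
  · rw [plEval_eq_of_le fun x hx => (hδ x hx).2.trans hs, hdeg, hmom]
    simp
  · push_cast
    linarith
  · linarith

end Interval

/-! ### Metric graphs -/

namespace MetricGraph

variable {X E : Type*} [Fintype E] {Γ : MetricGraph X E}

theorem add_mem_principal {D D' : X →₀ ℤ} (h : D ∈ Γ.principal) (h' : D' ∈ Γ.principal) :
    D + D' ∈ Γ.principal := by
  obtain ⟨f, d, hd, rfl⟩ := h
  obtain ⟨f', d', hd', rfl⟩ := h'
  refine ⟨f + f', fun e => d e + d' e, fun e => ?_, ?_⟩
  · obtain ⟨h1, h2⟩ := (isDivOn_iff (Γ.len_nonneg e)).1 (hd e)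
    obtain ⟨h1', h2'⟩ := (isDivOn_iff (Γ.len_nonneg e)).1 (hd' e)
    refine (isDivOn_iff (Γ.len_nonneg e)).2 ⟨by rw [degree_add, h1, h1', add_zero], fun t => ?_⟩
    simp only [Pi.add_apply, map_add]
    rw [h2 t, h2' t]
    ring
  · simp only [Finsupp.mapDomain_add, Finset.sum_add_distrib]

theorem neg_mem_principal {D : X →₀ ℤ} (h : D ∈ Γ.principal) : -D ∈ Γ.principal := by
  obtain ⟨f, d, hd, rfl⟩ := h
  refine ⟨-f, fun e => -d e, fun e => ?_, ?_⟩
  · obtain ⟨h1, h2⟩ := (isDivOn_iff (Γ.len_nonneg e)).1 (hd e)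
    refine (isDivOn_iff (Γ.len_nonneg e)).2 ⟨by rw [degree_neg, h1, neg_zero], fun t => ?_⟩
    simp only [Pi.neg_apply, map_neg]
    rw [h2 t]
    ring
  · rw [← Finset.sum_neg_distrib]
    refine Finset.sum_congr rfl fun e _ => ?_
    exact ((Finsupp.mapDomain.addMonoidHom _).map_neg (d e)).symm

theorem degree_of_mem_principal {D : X →₀ ℤ} (h : D ∈ Γ.principal) : degree D = 0 := by
  obtain ⟨f, d, hd, rfl⟩ := h
  rw [degree_sum]
  refine Finset.sum_eq_zero fun e _ => ?_
  rw [degree_mapDomain]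
  exact ((isDivOn_iff (Γ.len_nonneg e)).1 (hd e)).1

/-- Strict subdivisions of the intervals of a metric graph such that all identified points are
subdivision points. -/
structure Model (Γ : MetricGraph X E) where
  /-- the number of segments of an interval -/
  n : E → ℕ
  /-- the subdivision points -/
  node : ∀ e, Fin (n e + 1) → Icc (0 : ℝ) (Γ.len e)
  strictMono : ∀ e, StrictMono (node e)
  node_zero : ∀ e, (node e 0 : ℝ) = 0
  node_last : ∀ e, (node e (Fin.last (n e)) : ℝ) = Γ.len e
  exists_node : ∀ p q : Σ e, Icc (0 : ℝ) (Γ.len e), q ≠ p → Γ.param q = Γ.param p →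
    ∃ k, node p.1 k = p.2

variable (Γ) in
theorem nonempty_model : Nonempty Γ.Model := by
  have h := fun e => exists_subdivision (Γ.len_nonneg e)
    (Γ.finite_ident.preimage (sigma_mk_injective (i := e)).injOn).toFinset
  choose n t h1 h2 h3 h4 using h
  refine ⟨n, t, h1, h2, h3, ?_⟩
  rintro ⟨e, s⟩ q hne hq
  exact h4 e s ((Finite.mem_toFinset _).2 ⟨q, hne, hq⟩)

/-! ### Models: reducing a metric graph to a weighted finite graph -/

namespace Model

variable (M : Γ.Model)

/-- The vertices of a model: the images of the subdivision points. -/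
def vert : Set X := range fun k : Σ e, Fin (M.n e + 1) => Γ.param ⟨k.1, M.node k.1 k.2⟩

/-- The segments of a model. -/
abbrev Seg : Type _ := Σ e, Fin (M.n e)

/-- The vertex given by a subdivision point. -/
def toVert (e : E) (k : Fin (M.n e + 1)) : M.vert := ⟨_, ⟨e, k⟩, rfl⟩

/-- The left end of a segment. -/
def left (j : M.Seg) : Icc (0 : ℝ) (Γ.len j.1) := M.node j.1 j.2.castSucc

/-- The right end of a segment. -/
def right (j : M.Seg) : Icc (0 : ℝ) (Γ.len j.1) := M.node j.1 j.2.succ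

/-- The vertex at the left end of a segment. -/
def src (j : M.Seg) : M.vert := M.toVert j.1 j.2.castSucc

/-- The vertex at the right end of a segment. -/
def tgt (j : M.Seg) : M.vert := M.toVert j.1 j.2.succ

theorem left_lt_right (j : M.Seg) : M.left j < M.right j := M.strictMono _ j.2.castSucc_lt_succ

theorem finite_vert : M.vert.Finite := finite_range _

/-- Topological connectedness becomes combinatorial: such a `g` is constant along each interval, and
identified points are nodes, so it extends to a locally constant function on the whole space. -/
theorem eq_of_forall_src_eq_tgt (g : M.vert → ℝ) (hg : ∀ j, g (M.src j) = g (M.tgt j))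
    (x y : M.vert) : g x = g y := by
  have hnode : ∀ e k, g (M.toVert e k) = g (M.toVert e 0) := by
    intro e k
    induction k using Fin.induction with
    | zero => rfl
    | succ i ih => exact (hg ⟨e, i⟩).symm.trans ih
  have hp : ∀ p q, Γ.param p = Γ.param q → g (M.toVert p.1 0) = g (M.toVert q.1 0) := by
    intro p q h
    by_cases hne : p = q
    · rw [hne]
    · obtain ⟨k, hk⟩ := M.exists_node p q (Ne.symm hne) h.symm
      obtain ⟨l, hl⟩ := M.exists_node q p hne h
      rw [← hnode p.1 k, ← hnode q.1 l]
      congr 1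
      refine Subtype.ext ?_
      change Γ.param ⟨p.1, M.node p.1 k⟩ = Γ.param ⟨q.1, M.node q.1 l⟩
      rw [hk, hl]
      exact h
  let H : X → ℝ := fun x => g (M.toVert (Function.surjInv Γ.surjective x).1 0)
  have hH : ∀ p, H (Γ.param p) = g (M.toVert p.1 0) := fun p =>
    hp _ _ (Function.surjInv_eq Γ.surjective _)
  let _ : TopologicalSpace X := TopologicalSpace.coinduced Γ.param inferInstance
  have _ : ConnectedSpace X := Γ.connected
  have hloc : IsLocallyConstant H := by
    intro s
    rw [isOpen_coinduced, isOpen_sigma_iff]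
    intro e
    have : Sigma.mk e ⁻¹' (Γ.param ⁻¹' (H ⁻¹' s)) = {_t | g (M.toVert e 0) ∈ s} := by
      ext t
      simp only [mem_preimage, hH, mem_ofPred_eq]
    rw [this]
    exact isOpen_const
  have hx : ∀ x : M.vert, g x = H x := by
    rintro ⟨_, ⟨e, k⟩, rfl⟩
    exact (hnode e k).trans (hH ⟨e, M.node e k⟩).symm
  rw [hx, hx]
  exact hloc.apply_eq_of_preconnectedSpace _ _

open Classical in
theorem exists_eq_add_sum (D : X →₀ ℤ) :
    ∃ (D₀ : X →₀ ℤ) (d : ∀ j : M.Seg, Icc (0 : ℝ) (Γ.len j.1) →₀ ℤ),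
      (∀ x, x ∉ M.vert → D₀ x = 0) ∧ (∀ j s, d j s ≠ 0 → s ∈ Icc (M.left j) (M.right j)) ∧
      D = D₀ + ∑ j, (d j).mapDomain fun t => Γ.param ⟨j.1, t⟩ := by
  induction D using Finsupp.induction_linear with
  | zero => exact ⟨0, 0, fun _ _ => rfl, fun j s h => absurd rfl h, by simp⟩
  | add D D' h h' =>
    obtain ⟨D₀, d, h1, h2, rfl⟩ := h
    obtain ⟨D₀', d', h1', h2', rfl⟩ := h'
    refine ⟨D₀ + D₀', d + d', fun x hx => ?_, fun j s hs => ?_, ?_⟩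
    · rw [Finsupp.add_apply, h1 x hx, h1' x hx, add_zero]
    · by_cases h : d j s = 0
      · refine h2' j s fun h' => hs ?_
        rw [Pi.add_apply, Finsupp.add_apply, h, h', add_zero]
      · exact h2 j s h
    · simp only [Pi.add_apply, Finsupp.mapDomain_add, Finset.sum_add_distrib]
      abel
  | single x n =>
    obtain ⟨⟨e, t⟩, rfl⟩ := Γ.surjective x
    -- The first alternative covers intervals of length zero, which have a node but no segment.
    rcases exists_mem_Icc_castSucc_succ (M.node e) (s := t)
      (by rw [← Subtype.coe_le_coe, M.node_zero]; exact t.2.1)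
      (by rw [← Subtype.coe_le_coe, M.node_last]; exact t.2.2) with rfl | ⟨i, hi⟩
    · refine ⟨_, 0, fun x hx => ?_, fun j s h => absurd rfl h, by simp; rfl⟩
      rw [Finsupp.single_apply, if_neg]
      rintro rfl
      exact hx ⟨⟨e, 0⟩, rfl⟩
    · refine ⟨0, Pi.single ⟨e, i⟩ (Finsupp.single t n), fun _ _ => rfl, fun j s hs => ?_, ?_⟩
      · by_cases hj : j = ⟨e, i⟩
        · subst hj
          rw [Pi.single_eq_same, Finsupp.single_apply] at hs
          have : t = s := by
            by_contra h
            simp [h] at hs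
          exact this ▸ hi
        · rw [Pi.single_eq_of_ne hj] at hs
          exact absurd rfl hs
      · rw [Finset.sum_eq_single (⟨e, i⟩ : M.Seg)]
        · rw [Pi.single_eq_same, Finsupp.mapDomain_single, zero_add]
        · intro j _ hj
          rw [Pi.single_eq_of_ne hj, Finsupp.mapDomain_zero]
        · simp

/-- Divisors on the segments with the increments of a function on the vertices give a principal
divisor. -/
theorem sum_mapDomain_mem_principal (f : M.vert → ℝ)
    (δ : ∀ j : M.Seg, Icc (0 : ℝ) (Γ.len j.1) →₀ ℤ) (hdeg : ∀ j, degree (δ j) = 0)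
    (hleft : ∀ (j : M.Seg) (s : Icc (0 : ℝ) (Γ.len j.1)), s ≤ M.left j → plEval s (δ j) = 0)
    (hright : ∀ (j : M.Seg) (s : Icc (0 : ℝ) (Γ.len j.1)), M.right j ≤ s →
      plEval s (δ j) = f (M.tgt j) - f (M.src j)) :
    ∑ j, (δ j).mapDomain (fun t => Γ.param ⟨j.1, t⟩) ∈ Γ.principal := by
  let Δ : ∀ e, Icc (0 : ℝ) (Γ.len e) →₀ ℤ := fun e => ∑ i, δ ⟨e, i⟩
  -- Integrating the segment divisors along each interval reproduces `f` at every node; identified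
  -- points are nodes, so `G` descends to the graph.
  let G : (Σ e, Icc (0 : ℝ) (Γ.len e)) → ℝ := fun p =>
    f (M.toVert p.1 0) + plEval p.2 (Δ p.1)
  have hnode : ∀ e k, G ⟨e, M.node e k⟩ = f (M.toVert e k) := by
    intro e k
    induction k using Fin.induction with
    | zero => simp only [G, M.node_zero, plEval_zero, add_zero]
    | succ i ih =>
      have hmono := (M.strictMono e).monotone
      have h : plEval (M.node e i.succ) (Δ e) - plEval (M.node e i.castSucc) (Δ e) =
          f (M.toVert e i.succ) - f (M.toVert e i.castSucc) := by
        rw [map_sum, map_sum, ← Finset.sum_sub_distrib, Finset.sum_eq_single i]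
        · rw [hleft ⟨e, i⟩ (M.node e i.castSucc) le_rfl,
            hright ⟨e, i⟩ (M.node e i.succ) le_rfl, sub_zero]
          rfl
        · intro l _ hl
          rcases lt_or_gt_of_ne hl with h | h
          · have h1 : M.right ⟨e, l⟩ ≤ M.node e i.castSucc :=
              hmono (Fin.succ_le_castSucc_iff.2 h)
            rw [hright ⟨e, l⟩ _ h1, hright ⟨e, l⟩ _ (h1.trans (hmono i.castSucc_le_succ)),
              sub_self]
          · have h1 : M.node e i.succ ≤ M.left ⟨e, l⟩ :=
              hmono (Fin.succ_le_castSucc_iff.2 h)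
            rw [hleft ⟨e, l⟩ _ h1, hleft ⟨e, l⟩ _ ((hmono i.castSucc_le_succ).trans h1),
              sub_self]
        · simp
      simp only [G] at ih ⊢
      linarith
  have hp : ∀ p q, Γ.param p = Γ.param q → G p = G q := by
    intro p q h
    by_cases hne : p = q
    · rw [hne]
    · obtain ⟨e, s⟩ := p
      obtain ⟨e', s'⟩ := q
      obtain ⟨k, rfl⟩ : ∃ k, M.node e k = s := M.exists_node ⟨e, s⟩ _ (Ne.symm hne) h.symm
      obtain ⟨l, rfl⟩ : ∃ l, M.node e' l = s' := M.exists_node ⟨e', s'⟩ _ hne h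
      rw [hnode, hnode]
      exact congrArg f (Subtype.ext h)
  let H : X → ℝ := fun x => G (Function.surjInv Γ.surjective x)
  have hH : ∀ p, H (Γ.param p) = G p := fun p => hp _ _ (Function.surjInv_eq Γ.surjective _)
  refine ⟨H, Δ, fun e => ?_, ?_⟩
  · refine (isDivOn_iff (Γ.len_nonneg e)).2 ⟨?_, fun t => ?_⟩
    · rw [degree_sum]
      exact Finset.sum_eq_zero fun i _ => hdeg _
    · simp only [hH, G, plEval_zero, add_zero]
  · rw [Fintype.sum_sigma]
    refine Finset.sum_congr rfl fun e _ => ?_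
    rw [Finsupp.mapDomain_finsetSum]

end Model

variable (Γ) in
-- On a model, each segment pushes its chips to its ends by `exists_segment_divisor`. The vertex
-- function `f` is chosen so that the resulting end coefficients and `D₀` together are nonnegative;
-- inside segments only the single chips `u j` remain.
theorem isRiemann : IsRiemann Γ.principal := by
  classical
  obtain ⟨M⟩ := Γ.nonempty_model
  have hX : Nonempty X := by
    let _ : TopologicalSpace X := TopologicalSpace.coinduced Γ.param inferInstance
    have _ : ConnectedSpace X := Γ.connected
    infer_instance
  have : Fintype M.vert := M.finite_vert.fintype
  obtain ⟨q⟩ : Nonempty M.vert := by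
    obtain ⟨x⟩ := hX
    obtain ⟨⟨e, t⟩, -⟩ := Γ.surjective x
    exact ⟨M.toVert e 0⟩
  refine ⟨hX, fun D hD E hE => add_mem_principal hD hE, fun D hD => neg_mem_principal hD,
    fun D hD => degree_of_mem_principal hD, 2 * Fintype.card M.Seg, fun D hN => ?_⟩
  obtain ⟨D₀, d, hD₀, hd, hD⟩ := M.exists_eq_add_sum D
  let len : M.Seg → ℝ := fun j => M.right j - M.left j
  have hlen : ∀ j, 0 < len j := fun j => sub_pos.2 (M.left_lt_right j)
  let ρ : M.Seg → ℝ := fun j => (moment (d j) - degree (d j) * M.left j) / len j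
  have hdegD : (∑ x : M.vert, (D₀ x : ℝ)) + ∑ j, (degree (d j) : ℝ) = degree D := by
    have h1 : degree D = degree D₀ + ∑ j, degree (d j) := by
      rw [hD, degree_add, degree_sum]
      simp only [degree_mapDomain]
    have h2 : degree D₀ = ∑ x : M.vert, D₀ x := by
      rw [← Finset.sum_subtype M.vert.toFinset (fun x => mem_toFinset) fun x => D₀ x]
      refine Finsupp.sum_of_support_subset _ (fun x hx => ?_) _ fun _ _ => rfl
      by_contra h
      exact Finsupp.mem_support_iff.1 hx (hD₀ x fun h' => h (mem_toFinset.2 h'))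
    rw [h1, h2]
    push_cast
    rfl
  -- Raising the increment on segment `j` by `c` moves `c / len j` chips from its right end to its
  -- left, hence the conductances. The terms `-1` allow for rounding at each end, and `q` carries
  -- the surplus that makes the total zero.
  obtain ⟨f, hf⟩ := exists_laplacian_eq M.src M.tgt (fun j => (len j)⁻¹)
    (fun j => inv_pos.2 (hlen j)) M.eq_of_forall_src_eq_tgt
    (fun x => (if q = x then (degree D - 2 * Fintype.card M.Seg : ℝ) else 0) - D₀ x -
      ∑ j, ((degree (d j) - 1 - ρ j) * (if M.src j = x then 1 else 0) +
        (ρ j - 1) * (if M.tgt j = x then 1 else 0))) (by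
      rw [Finset.sum_sub_distrib, Finset.sum_sub_distrib, Finset.sum_comm (s := Finset.univ),
        ← hdegD]
      simp only [Finset.sum_add_distrib, ← Finset.mul_sum, Finset.sum_ite_eq, Finset.mem_univ,
        if_true, mul_one, Finset.sum_sub_distrib, Finset.sum_const, Finset.card_univ,
        nsmul_eq_mul]
      ring)
  have hseg := fun j => exists_segment_divisor (M.left_lt_right j) (hd j)
    (f (M.tgt j) - f (M.src j))
  choose u α β δ hδ hdeg hleft hright hα hβ using hseg
  have hmem := M.sum_mapDomain_mem_principal f δ hdeg hleft hright
  refine ⟨D + ∑ j, (δ j).mapDomain (fun t => Γ.param ⟨j.1, t⟩), fun x => ?_, ?_⟩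
  rotate_left
  · unfold LinEquiv
    rw [sub_add_cancel_left]
    exact neg_mem_principal hmem
  · have hF : D + ∑ j, (δ j).mapDomain (fun t => Γ.param ⟨j.1, t⟩) =
        D₀ + ∑ j, (Finsupp.single (Γ.param ⟨j.1, u j⟩) 1 + Finsupp.single (M.src j : X) (α j) +
          Finsupp.single (M.tgt j : X) (β j)) := by
      rw [hD, add_assoc, ← Finset.sum_add_distrib]
      congr 1
      refine Finset.sum_congr rfl fun j _ => ?_
      rw [← Finsupp.mapDomain_add, hδ, Finsupp.mapDomain_add, Finsupp.mapDomain_add,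
        Finsupp.mapDomain_single, Finsupp.mapDomain_single, Finsupp.mapDomain_single]
      rfl
    rw [hF, Finsupp.coe_zero, Pi.zero_apply, Finsupp.add_apply, Finsupp.finsetSum_apply]
    simp only [Finsupp.add_apply, Finsupp.single_apply]
    by_cases hx : x ∈ M.vert
    · have hfx := hf ⟨x, hx⟩
      have hq : 0 ≤ (if q = ⟨x, hx⟩ then (degree D - 2 * Fintype.card M.Seg : ℝ) else 0) := by
        split_ifs
        · have : ((2 * Fintype.card M.Seg : ℤ) : ℝ) ≤ degree D := Int.cast_le.2 hN
          push_cast at this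
          linarith
        · exact le_rfl
      rw [← Int.cast_le (R := ℝ)]
      push_cast
      have hle : ∑ j, ((len j)⁻¹ * (f (M.tgt j) - f (M.src j)) *
            ((if M.src j = ⟨x, hx⟩ then 1 else 0) - (if M.tgt j = ⟨x, hx⟩ then 1 else 0)) +
          ((degree (d j) - 1 - ρ j) * (if M.src j = ⟨x, hx⟩ then 1 else 0) +
            (ρ j - 1) * (if M.tgt j = ⟨x, hx⟩ then 1 else 0))) ≤
          ∑ j, ((if Γ.param ⟨j.1, u j⟩ = x then (1 : ℝ) else 0) +
            (if (M.src j : X) = x then (α j : ℝ) else 0) +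
            (if (M.tgt j : X) = x then (β j : ℝ) else 0)) := by
        refine Finset.sum_le_sum fun j _ => ?_
        have h1 := hα j
        have h2 := hβ j
        have h3 : (moment (d j) - degree (d j) * M.left j - (f (M.tgt j) - f (M.src j))) /
            (M.right j - M.left j) = ρ j - (len j)⁻¹ * (f (M.tgt j) - f (M.src j)) := by
          rw [sub_div, div_eq_inv_mul (f (M.tgt j) - f (M.src j))]
        rw [h3] at h1 h2
        have h4 : (0 : ℝ) ≤ if Γ.param ⟨j.1, u j⟩ = x then (1 : ℝ) else 0 := by
          split_ifs <;> norm_num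
        simp only [Subtype.ext_iff]
        generalize (if Γ.param ⟨j.1, u j⟩ = x then (1 : ℝ) else 0) = r at h4 ⊢
        split_ifs <;> linarith
      rw [Finset.sum_add_distrib, hfx] at hle
      linarith
    · rw [hD₀ x hx, zero_add]
      refine Finset.sum_nonneg fun j _ => ?_
      rw [if_neg fun h : (M.src j : X) = x => hx (h ▸ (M.src j).2),
        if_neg fun h : (M.tgt j : X) = x => hx (h ▸ (M.tgt j).2)]
      split_ifs <;> norm_num

variable {X' E' : Type*} [Fintype E'] (Γ' : MetricGraph X' E')

variable (Γ) in
theorem isGlued (w : X) (z : X') :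
    IsGlued Γ.principal Γ'.principal (Γ.vertexGluing Γ' w z).principal := by
  have hmap : ∀ (d : ∀ e, Icc (0 : ℝ) (Γ.len e) →₀ ℤ) (d' : ∀ e, Icc (0 : ℝ) (Γ'.len e) →₀ ℤ),
      glueDiv w z (∑ e, (d e).mapDomain fun t => Γ.param ⟨e, t⟩)
        (∑ e, (d' e).mapDomain fun t => Γ'.param ⟨e, t⟩) =
      (∑ e, (d e).mapDomain fun t => Wedge.inl (Γ.param ⟨e, t⟩)) +
        ∑ e, (d' e).mapDomain fun t => Wedge.inr (Γ'.param ⟨e, t⟩) := by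
    intro d d'
    simp only [glueDiv, Finsupp.mapDomain_finsetSum, ← Finsupp.mapDomain_comp]
    rfl
  intro F
  constructor
  · rintro ⟨f, d, hd, rfl⟩
    refine ⟨_, ⟨fun x => f (Wedge.inl x), fun e => d (Sum.inl e), fun e => hd (Sum.inl e), rfl⟩,
      _, ⟨fun y => f (Wedge.inr y), fun e => d (Sum.inr e), fun e => hd (Sum.inr e), rfl⟩, ?_⟩
    exact (Fintype.sum_sum_type _).trans
      (hmap (fun e => d (Sum.inl e)) fun e => d (Sum.inr e)).symm
  · rintro ⟨_, ⟨f, d, hd, rfl⟩, _, ⟨g, d', hd', rfl⟩, rfl⟩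
    -- The constant matching the values at the glued point cancels in `isDivOn_iff`, where only the
    -- difference from the initial value matters.
    refine ⟨Quot.lift (Sum.elim f fun y => g y - g z + f w) ?_,
      Sum.rec (motive := fun e => Icc (0 : ℝ) ((Γ.vertexGluing Γ' w z).len e) →₀ ℤ) d d', ?_, ?_⟩
    · rintro _ _ ⟨rfl, rfl⟩
      simp
    · rintro (e | e)
      · exact hd e
      · obtain ⟨h1, h2⟩ := (isDivOn_iff (Γ'.len_nonneg e)).1 (hd' e)
        refine (isDivOn_iff (Γ'.len_nonneg e)).2 ⟨h1, fun t => ?_⟩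
        change g (Γ'.param ⟨e, t⟩) - g z + f w =
          g (Γ'.param ⟨e, ⟨0, _⟩⟩) - g z + f w + plEval (t : ℝ) (d' e)
        rw [h2 t]
        ring
    · rw [hmap, Fintype.sum_sum_type]
      rfl

end MetricGraph

end VertexGluing

end

/-! ### The theorem for finite and for metric graphs -/

theorem mainTheorem4 :
    -- finite graphs
    (∀ {V₁ E₁ V₂ E₂ : Type*} (G₁ : FiniteGraph V₁ E₁) (G₂ : FiniteGraph V₂ E₂)
        (v₁ w₁ : V₁) (v₂ w₂ : V₂) (D₁ : V₁ →₀ ℤ) (D₂ : V₂ →₀ ℤ)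
        (D : Wedge w₁ v₂ →₀ ℤ), D = D₁.mapDomain Wedge.inl + D₂.mapDomain Wedge.inr →
      transmission (G₁.vertexGluing G₂ w₁ v₂).principal (Wedge.inl v₁) (Wedge.inr w₂) D
          = tropMul (transmission G₁.principal v₁ w₁ D₁) (transmission G₂.principal v₂ w₂ D₂) ∧
      (Submodular G₁.principal v₁ w₁ D₁ → Submodular G₂.principal v₂ w₂ D₂ →
        Submodular (G₁.vertexGluing G₂ w₁ v₂).principal (Wedge.inl v₁) (Wedge.inr w₂) D →
        ∃ τ₁ τ₂ τ : Equiv.Perm ℤ,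
          IsTransmissionPerm G₁.principal v₁ w₁ D₁ τ₁ ∧
          IsTransmissionPerm G₂.principal v₂ w₂ D₂ τ₂ ∧
          IsTransmissionPerm (G₁.vertexGluing G₂ w₁ v₂).principal
            (Wedge.inl v₁) (Wedge.inr w₂) D τ ∧
          IsDemazureProduct τ₁ τ₂ τ)) ∧
    -- metric graphs
    (∀ {X₁ E₁ X₂ E₂ : Type*} [Fintype E₁] [Fintype E₂]
        (Γ₁ : MetricGraph X₁ E₁) (Γ₂ : MetricGraph X₂ E₂)
        (v₁ w₁ : X₁) (v₂ w₂ : X₂) (D₁ : X₁ →₀ ℤ) (D₂ : X₂ →₀ ℤ)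
        (D : Wedge w₁ v₂ →₀ ℤ), D = D₁.mapDomain Wedge.inl + D₂.mapDomain Wedge.inr →
      transmission (Γ₁.vertexGluing Γ₂ w₁ v₂).principal (Wedge.inl v₁) (Wedge.inr w₂) D
          = tropMul (transmission Γ₁.principal v₁ w₁ D₁) (transmission Γ₂.principal v₂ w₂ D₂) ∧
      (Submodular Γ₁.principal v₁ w₁ D₁ → Submodular Γ₂.principal v₂ w₂ D₂ →
        Submodular (Γ₁.vertexGluing Γ₂ w₁ v₂).principal (Wedge.inl v₁) (Wedge.inr w₂) D →
        ∃ τ₁ τ₂ τ : Equiv.Perm ℤ,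
          IsTransmissionPerm Γ₁.principal v₁ w₁ D₁ τ₁ ∧
          IsTransmissionPerm Γ₂.principal v₂ w₂ D₂ τ₂ ∧
          IsTransmissionPerm (Γ₁.vertexGluing Γ₂ w₁ v₂).principal
            (Wedge.inl v₁) (Wedge.inr w₂) D τ ∧
          IsDemazureProduct τ₁ τ₂ τ)) := by
  refine ⟨?_, ?_⟩
  · rintro V₁ E₁ V₂ E₂ G₁ G₂ v₁ w₁ v₂ w₂ D₁ D₂ _ rfl
    exact IsGlued.main (G₁.isRiemann v₁) (G₂.isRiemann v₂)
      ((G₁.vertexGluing G₂ w₁ v₂).isRiemann (Wedge.inl v₁)) (G₁.isGlued G₂ w₁ v₂)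
  · rintro X₁ E₁ X₂ E₂ _ _ Γ₁ Γ₂ v₁ w₁ v₂ w₂ D₁ D₂ _ rfl
    exact IsGlued.main Γ₁.isRiemann Γ₂.isRiemann (Γ₁.vertexGluing Γ₂ w₁ v₂).isRiemann
      (Γ₁.isGlued Γ₂ w₁ v₂)
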